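/- Let $K$ be a non-archimedean local field of characteristic $p>0$ with ring of integers $\mathcal{O}_K$, unit group $\mathcal{O}_K^\times$, a fixed uniformizer $\pi$, and residue field with $q$ elements. For $x\in K^\times$ write $x=ac(x)\,\pi^{\mathrm{ord}(x)}$ with $ac(x)\in\mathcal{O}_K^\times$, and put $|x|=q^{-\mathrm{ord}(x)}$, $|0|=0$. Let $|dx\,dy|$ be the Haar measure on $K^2$ normalized so that $\mathcal{O}_K^2$ has measure $1$. Let $\chi:\mathcal{O}_K^\times\to\mathbb{C}^\times$ be a continuous multiplicative character, with the convention $\chi(ac(0))=0$. For a polynomial $g\in\mathcal{O}_K[x,y]$ and $s\in\mathbb{C}$ with $\mathrm{Re}(s)>0$ let $$Z_g(s,\chi)=\int_{\mathcal{O}_K^2}\chi(ac\,g(x,y))\,|g(x,y)|^s\,|dx\,dy|.$$ **Theorem 1.2.** Let $m\ge 2$ be an integer with $p\nmid m$, and let $f\in\mathcal{O}_K[x]$ be a nonzero polynomial that splits completely over $K$: $f(x)=\gamma_0\prod_{i=1}^k(x-\gamma_i)^{n_i}$ with $\gamma_0\in K^\times$, pairwise distinct $\gamma_1,\dots,\gamma_k\in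 K$, and integers $n_i\ge 1$. Let $g(x,y)=y^m-f(x)$. Put $T=\{i : 1\le i\le k,\ \gamma_i\in\mathcal{O}_K\}$, $\tilde n_i=n_i/\gcd(n_i,m)$ and $m_i=m/\gcd(n_i,m)$. Then $Z_g(s,\chi)$ is a rational function of $q^{-s}$. More explicitly, there is a polynomial $G\in\mathbb{C}[x]$ (not depending on $s$) such that for all $s$ with $\mathrm{Re}(s)>0$ the integral $Z_g(s,\chi)$ converges absolutely and $$Z_g(s,\chi)=\frac{G(q^{-s})}{(1-q^{-1-s})\prod_{i\in T,\ n_i\ge 2}\bigl(1-q^{-\tilde n_i-m_i-\tilde n_i m_i\gcd(n_i,m)s}\bigr)}.$$ In particular the right-hand side continues $Z_g(s,\chi)$ to a meromorphic function on $\mathbb{C}$, and each of its poles is of the form $$s=-1+\frac{2\pi\sqrt{-1}\,l}{\log q}\qquad\text{or}\qquad s=\frac{1}{\tilde n_i m_i\gcd(n_i,m)}\Bigl(-(\tilde n_i+m_i)+\frac{2\pi\sqrt{-1}\,l}{\log q}\Bigr)$$ for some $l\in\mathbb{Z}$ and, in the second case, some $i\in T$ with $n_i\ge 2$. -/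

import Mathlib

open MeasureTheory Polynomial ValuativeRel

namespace LocalZeta

noncomputable section

variable {K : Type*} [Field K] [ValuativeRel K] [TopologicalSpace K]
  [IsNonarchimedeanLocalField K]

/-- The normalized valuation `ord : K → ℤ` of a non-archimedean local field, normalized to be onto
`ℤ` on the nonzero elements. The value at `0` is the junk value `0`; it is never used. -/
def ord (x : K) : ℤ :=
  -WithZero.log (IsNonarchimedeanLocalField.valueGroupWithZeroIsoInt K (valuation K x))

variable (K) in
/-- The cardinality `q` of the residue field. -/
def residueCard : ℕ := Nat.card 𝓀[K]

open Classical in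
/-- The normalized absolute value `|x| = q ^ (-ord x)`, with `|0| = 0`. -/
def absVal (x : K) : ℝ := if x = 0 then 0 else (residueCard K : ℝ) ^ (-ord x)

open Classical in
/-- `χ (ac x)` for a character `χ` of the unit group and a uniformizer `ϖ`: the angular component
`ac x` of `x ≠ 0` is the unit `u` with `x = u * ϖ ^ ord x` (it exists and is unique, see
`existsUnique_angular`). At `x = 0` there is no such unit and the value is `0`. -/
def charAC (ϖ : 𝒪[K]) (χ : (𝒪[K])ˣ →* ℂˣ) (x : K) : ℂ :=
  if h : ∃ u : (𝒪[K])ˣ, x = ((u : 𝒪[K]) : K) * (ϖ : K) ^ ord x then (χ h.choose : ℂ) else 0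

/-- The integrand `χ (ac (g z)) |g z| ^ s` of the local zeta function, for `g : K² → K`. -/
def zetaIntegrand (ϖ : 𝒪[K]) (χ : (𝒪[K])ˣ →* ℂˣ) (g : K × K → K) (s : ℂ) (z : K × K) : ℂ :=
  charAC ϖ χ (g z) * (absVal (g z) : ℂ) ^ s

variable (K) in
/-- The square `𝒪 × 𝒪` of the ring of integers, as a subset of `K²`. -/
def integerSquare : Set (K × K) := (𝒪[K] : Set K) ×ˢ (𝒪[K] : Set K)

/-- Igusa's local zeta function `∫_{𝒪²} χ (ac (g z)) |g z| ^ s |dz|` in two variables. Here `μ` is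
to be the Haar measure on `K` with `μ 𝒪 = 1`, so `μ.prod μ` is the one on `K²`. -/
def igusaZeta [MeasurableSpace K] (μ : Measure K) (ϖ : 𝒪[K]) (χ : (𝒪[K])ˣ →* ℂˣ)
    (g : K × K → K) (s : ℂ) : ℂ :=
  ∫ z in integerSquare K, zetaIntegrand ϖ χ g s z ∂(μ.prod μ)

lemma ord_mul {x y : K} (hx : x ≠ 0) (hy : y ≠ 0) : ord (x * y) = ord x + ord y := by
  unfold ord
  rw [map_mul, map_mul, WithZero.log_mul (by simpa using hx) (by simpa using hy)]
  ring

lemma ord_nonneg_iff {x : K} (hx : x ≠ 0) : 0 ≤ ord x ↔ x ∈ 𝒪[K] := by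
  unfold ord
  rw [Left.nonneg_neg_iff, ← WithZero.log_one, WithZero.log_le_log (by simpa using hx) (by simp),
    Valuation.mem_integer_iff]
  conv_lhs => rw [← map_one (IsNonarchimedeanLocalField.valueGroupWithZeroIsoInt K)]
  exact map_le_map_iff (IsNonarchimedeanLocalField.valueGroupWithZeroIsoInt K)

lemma ord_inv (x : K) : ord x⁻¹ = -ord x := by
  unfold ord
  simp

lemma ord_unit (u : (𝒪[K])ˣ) : ord ((u : 𝒪[K]) : K) = 0 := by
  have h1 : ((u : 𝒪[K]) : K) * ((↑u⁻¹ : 𝒪[K]) : K) = 1 := by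
    exact_mod_cast congrArg Subtype.val (u.mul_inv)
  have hu : ((u : 𝒪[K]) : K) ≠ 0 := left_ne_zero_of_mul_eq_one h1
  have hv : ((↑u⁻¹ : 𝒪[K]) : K) ≠ 0 := right_ne_zero_of_mul_eq_one h1
  have h2 := ord_mul hu hv
  have h3 : ord (1 : K) = 0 := by simp [ord]
  rw [h1, h3] at h2
  have h4 := (ord_nonneg_iff hu).2 (u : 𝒪[K]).2
  have h5 := (ord_nonneg_iff hv).2 (↑u⁻¹ : 𝒪[K]).2
  omega

/-- A nonzero element of order `0` is a unit of the ring of integers. -/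
lemma exists_unit_of_ord_eq_zero {x : K} (hx : x ≠ 0) (h : ord x = 0) :
    ∃ u : (𝒪[K])ˣ, ((u : 𝒪[K]) : K) = x := by
  have h1 : x ∈ 𝒪[K] := (ord_nonneg_iff hx).1 h.ge
  have h2 : x⁻¹ ∈ 𝒪[K] := (ord_nonneg_iff (inv_ne_zero hx)).1 (by rw [ord_inv x, h]; simp)
  exact ⟨⟨⟨x, h1⟩, ⟨x⁻¹, h2⟩, Subtype.ext (mul_inv_cancel₀ hx), Subtype.ext (inv_mul_cancel₀ hx)⟩,
    rfl⟩

/-- The valuation is normalized: uniformizers have order `1`. -/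
lemma ord_uniformizer {ϖ : 𝒪[K]} (hϖ : Irreducible ϖ) : ord (ϖ : K) = 1 := by
  have h0 : (ϖ : K) ≠ 0 := fun h => hϖ.ne_zero (Subtype.ext h)
  have hpos : 0 ≤ ord (ϖ : K) := (ord_nonneg_iff h0).2 ϖ.2
  have hne : ord (ϖ : K) ≠ 0 := fun h => by
    obtain ⟨u, hu⟩ := exists_unit_of_ord_eq_zero h0 h
    exact hϖ.not_isUnit ⟨u, Subtype.ext hu⟩
  obtain ⟨y, hy⟩ := ValuativeRel.valuation_surjective
    ((IsNonarchimedeanLocalField.valueGroupWithZeroIsoInt K).symm (WithZero.exp (-1 : ℤ)))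
  have hy1 : ord y = 1 := by
    unfold ord
    rw [hy]
    simp
  have hy0 : y ≠ 0 := by
    rintro rfl
    simp [ord] at hy1
  have hyO : y ∈ 𝒪[K] := (ord_nonneg_iff hy0).1 (by omega)
  have hdvd : ϖ ∣ (⟨y, hyO⟩ : 𝒪[K]) := by
    have hnu : ¬ IsUnit (⟨y, hyO⟩ : 𝒪[K]) := by
      rintro ⟨u, hu⟩
      have h1 := ord_unit u
      rw [hu] at h1
      simp only at h1
      omega
    have hmem : (⟨y, hyO⟩ : 𝒪[K]) ∈ IsLocalRing.maximalIdeal 𝒪[K] := hnu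
    rw [hϖ.maximalIdeal_eq] at hmem
    exact Ideal.mem_span_singleton.1 hmem
  obtain ⟨c, hc⟩ := hdvd
  have hc' : y = (ϖ : K) * (c : K) := congrArg Subtype.val hc
  have hc0 : (c : K) ≠ 0 := by
    intro h
    rw [h, mul_zero] at hc'
    exact hy0 hc'
  have h2 := ord_mul h0 hc0
  rw [← hc', hy1] at h2
  have h3 := (ord_nonneg_iff hc0).2 c.2
  omega

/-- Every nonzero element has exactly one angular component. -/
lemma existsUnique_angular {ϖ : 𝒪[K]} (hϖ : Irreducible ϖ) {x : K} (hx : x ≠ 0) :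
    ∃! u : (𝒪[K])ˣ, x = ((u : 𝒪[K]) : K) * (ϖ : K) ^ ord x := by
  have h0 : (ϖ : K) ≠ 0 := fun h => hϖ.ne_zero (Subtype.ext h)
  have hz : ∀ k : ℤ, ord ((ϖ : K) ^ k) = k := by
    intro k
    have h1 := ord_uniformizer hϖ
    unfold ord at h1 ⊢
    rw [map_zpow₀, map_zpow₀, WithZero.log_zpow, smul_eq_mul, ← mul_neg, h1, mul_one]
  have hk : (ϖ : K) ^ ord x ≠ 0 := zpow_ne_zero _ h0
  have hord : ord (x * ((ϖ : K) ^ ord x)⁻¹) = 0 := by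
    rw [ord_mul hx (inv_ne_zero hk), ord_inv _, hz]
    ring
  obtain ⟨u, hu⟩ := exists_unit_of_ord_eq_zero (mul_ne_zero hx (inv_ne_zero hk)) hord
  refine ⟨u, ?_, ?_⟩
  · simp only [hu]
    rw [inv_mul_cancel_right₀ hk]
  · intro v hv
    apply Units.ext
    apply Subtype.ext
    rw [hu, eq_mul_inv_iff_mul_eq₀ hk]
    exact hv.symm

lemma charAC_zero (ϖ : 𝒪[K]) (hϖ : Irreducible ϖ) (χ : (𝒪[K])ˣ →* ℂˣ) :
    charAC ϖ χ (0 : K) = 0 := by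
  have h0 : (ϖ : K) ≠ 0 := fun h => hϖ.ne_zero (Subtype.ext h)
  unfold charAC
  rw [dif_neg]
  rintro ⟨u, hu⟩
  rcases mul_eq_zero.1 hu.symm with h | h
  · exact u.ne_zero (Subtype.ext h)
  · exact zpow_ne_zero _ h0 h

/-- The factor `1 - q ^ (-n/d - m/d - (n/d) (m/d) d s)` with `d = gcd n m` that a root of
multiplicity `n` contributes to the denominator. The divisions by the gcd are exact. -/
def rootFactor (q m n : ℕ) (s : ℂ) : ℂ :=
  1 - (q : ℂ) ^ (-((n / n.gcd m : ℕ) : ℂ) - ((m / n.gcd m : ℕ) : ℂ)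
    - ((n / n.gcd m : ℕ) : ℂ) * ((m / n.gcd m : ℕ) : ℂ) * ((n.gcd m : ℕ) : ℂ) * s)

end

end LocalZeta

/-!
Integrate over `y` first. The inner integral of `y ^ m - c` is a function `J c` of `t = q ^ (-s)`.

* `J` is locally constant away from `c = 0`: a unit `v` close to `1` has `χ v = 1` and, by Hensel's
  lemma, is the `m`-th power of a unit `w`; substituting `w y` for `y` gives `J (c v) = J c`.
* For `c ≠ 0`, `J c` has the denominator `1 - q⁻¹ t`, which comes from the simple roots of
  `y ^ m = c`.
* `J (ϖ ^ m c) = A + q⁻¹ t ^ m J c` for small `c`, with `A` independent of `c` and `t`: the units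
  `y` contribute `A`, and the rest is rescaled by `ϖ`.

Near a root `γ` of multiplicity `n`, the function `f` is a constant times `(x - γ) ^ n` times a
unit close to `1`, so with `d = gcd n m` the substitution `x - γ ↦ ϖ ^ (m / d) (x - γ)` multiplies
`f` by `ϖ ^ (m (n / d))`, up to such a unit. Iterating the last identity `n / d` times gives a
linear equation for the integral over a small disc around `γ`, whose leading coefficient is the
factor contributed by `γ`. For `n = 1` one integrates over `x` before `y` instead, and no new factor
arises. By compactness, finitely many such discs and discs on which `J (f x)` is constant cover the
ring of integers.
-/

namespace LocalZeta

open Filter Topology IsLocalRing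
open scoped Pointwise NNReal

section PrincipalUnits

variable {R : Type*} [CommRing R]

/-- The principal units of level `I`, that is the units congruent to `1` modulo the ideal `I`.
A continuous character is trivial on those of some nonzero level. -/
def principalUnits (I : Ideal R) : Subgroup Rˣ :=
  (Units.map (Ideal.Quotient.mk I : R →* R ⧸ I)).ker

lemma mem_principalUnits {I : Ideal R} {u : Rˣ} : u ∈ principalUnits I ↔ (u : R) - 1 ∈ I := by
  rw [principalUnits, MonoidHom.mem_ker, Units.ext_iff]
  exact Ideal.Quotient.eq

variable [IsLocalRing R] {I : Ideal R}

lemma exists_eq_mul_principalUnit (hI : I ≠ ⊤) {x : R} {u : Rˣ} (h : x - u ∈ I) :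
    ∃ v ∈ principalUnits I, x = u * v := by
  have hx : IsUnit x := by
    refine notMem_maximalIdeal.1 fun hx => notMem_maximalIdeal.2 u.isUnit ?_
    exact ((maximalIdeal R).sub_mem_iff_right hx).1 (le_maximalIdeal hI h)
  obtain ⟨w, rfl⟩ := hx
  refine ⟨u⁻¹ * w, mem_principalUnits.2 ?_, by simp⟩
  simpa [mul_sub] using I.mul_mem_left ((u⁻¹ : Rˣ) : R) h

lemma exists_geomSum_eq_natCast_mul (hI : I ≠ ⊤) {m : ℕ} (hm : IsUnit (m : R)) {a : R}
    (ha : a - 1 ∈ I) :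
    ∃ w ∈ principalUnits I, ∑ i ∈ Finset.range m, a ^ i = m * (w : R) := by
  obtain ⟨u, hu⟩ := hm
  have hsum : ∑ i ∈ Finset.range m, a ^ i - u ∈ I := by
    have hmk : Ideal.Quotient.mk I a = 1 := Ideal.Quotient.eq.2 ha
    rw [← Ideal.Quotient.eq]
    simp [hmk, hu]
  simpa only [hu] using exists_eq_mul_principalUnit hI hsum

lemma exists_principalUnit_pow_eq [HenselianRing R (maximalIdeal R)] (hI : I ≠ ⊤) {m : ℕ}
    (hm : IsUnit (m : R)) {u : Rˣ} (hu : u ∈ principalUnits I) :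
    ∃ v ∈ principalUnits I, v ^ m = u := by
  have hm0 : m ≠ 0 := by rintro rfl; simp at hm
  have hu1 := mem_principalUnits.1 hu
  have hu1' : 1 - (u : R) ∈ maximalIdeal R := neg_sub (u : R) 1 ▸ neg_mem (le_maximalIdeal hI hu1)
  obtain ⟨a, ha, ha1⟩ := HenselianRing.is_henselian (I := maximalIdeal R) (X ^ m - C (u : R))
    (monic_X_pow_sub_C _ hm0) 1 (by simpa using hu1')
    (by simpa [derivative_X_pow] using hm.map (Ideal.Quotient.mk (maximalIdeal R)))
  have ham : a ^ m = u := by simpa [sub_eq_zero] using ha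
  obtain ⟨w, -, hw⟩ := exists_geomSum_eq_natCast_mul
    (maximalIdeal.isMaximal R).ne_top hm ha1
  have hunit : IsUnit (∑ i ∈ Finset.range m, a ^ i) := hw ▸ hm.mul w.isUnit
  have haI : a - 1 ∈ I := by
    rw [← Ideal.mul_unit_mem_iff_mem I hunit, mul_comm, geom_sum_mul, ham]
    exact hu1
  obtain ⟨v, hv, rfl⟩ := exists_eq_mul_principalUnit (u := 1) hI haI
  exact ⟨v, hv, Units.ext (by simpa using ham)⟩

end PrincipalUnits

section Discs

variable {K : Type*} [Field K] [ValuativeRel K]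

lemma uniformizer_ne_zero {ϖ : 𝒪[K]} (hϖ : Irreducible ϖ) : (ϖ : K) ≠ 0 :=
  fun h => hϖ.ne_zero (Subtype.ext h)

/-- The disc `a + c 𝒪` of centre `a` and radius `|c|`. The discs with `c` a power of the uniformizer
form a basis of neighbourhoods and serve to localize integrals. -/
def disc (a c : K) : Set K := (fun z => a + c * z) '' (𝒪[K] : Set K)

lemma mem_disc {a c x : K} (hc : c ≠ 0) : x ∈ disc a c ↔ (x - a) / c ∈ 𝒪[K] := by
  constructor
  · rintro ⟨z, hz, rfl⟩
    simpa [hc] using hz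
  · intro h
    exact ⟨_, h, by field_simp; ring⟩

lemma self_mem_disc (a c : K) : a ∈ disc a c := ⟨0, zero_mem 𝒪[K], by simp⟩

lemma disc_subset_integers {a c : K} (ha : a ∈ 𝒪[K]) (hc : c ∈ 𝒪[K]) :
    disc a c ⊆ (𝒪[K] : Set K) := by
  rintro _ ⟨z, hz, rfl⟩
  exact add_mem ha (mul_mem hc hz)

variable [TopologicalSpace K] [IsNonarchimedeanLocalField K]

lemma ord_zpow (x : K) (k : ℤ) : ord (x ^ k) = k * ord x := by
  unfold ord
  rw [map_zpow₀, map_zpow₀, WithZero.log_zpow, smul_eq_mul, ← mul_neg]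

lemma exists_eq_unit_mul_zpow {ϖ : 𝒪[K]} (hϖ : Irreducible ϖ) {x : K} (hx : x ≠ 0) :
    ∃ u : (𝒪[K])ˣ, x = ((u : 𝒪[K]) : K) * (ϖ : K) ^ ord x :=
  (existsUnique_angular hϖ hx).exists

lemma isCompact_integers : IsCompact (𝒪[K] : Set K) :=
  isCompact_iff_compactSpace.2 (inferInstanceAs (CompactSpace 𝒪[K]))

lemma isOpen_integers : IsOpen (𝒪[K] : Set K) :=
  Valuation.isOpen_integer (v := valuation K)

instance t2Space : T2Space K := by
  refine IsTopologicalAddGroup.t2Space_of_zero_sep fun x hx => ?_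
  refine ⟨{y | valuation K y < valuation K x}, ?_, by simp⟩
  exact (IsValuativeTopology.hasBasis_nhds_zero' K).mem_of_mem (by simpa using hx)

lemma tendsto_uniformizer_pow {ϖ : 𝒪[K]} (hϖ : Irreducible ϖ) :
    Tendsto (fun e : ℕ => (ϖ : K) ^ e) atTop (𝓝 0) := by
  have hlt : valuation K ϖ < 1 := Valuation.integer.v_irreducible_lt_one hϖ
  have : MulArchimedean (ValueGroupWithZero K) :=
    ValuativeRel.isRankLeOne_iff_mulArchimedean.1 inferInstance
  refine (IsValuativeTopology.hasBasis_nhds_zero' K).tendsto_right_iff.2 fun r hr => ?_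
  obtain ⟨e₀, he₀⟩ := exists_pow_lt₀ hlt (Units.mk0 r hr)
  filter_upwards [eventually_ge_atTop e₀] with e he
  rw [map_pow]
  exact (pow_le_pow_right_of_le_one' hlt.le he).trans_lt he₀

lemma isCompact_disc (a c : K) : IsCompact (disc a c) :=
  isCompact_integers.image (by fun_prop)

lemma isOpen_disc (a : K) {c : K} (hc : c ≠ 0) : IsOpen (disc a c) := by
  have : disc a c = (fun x => (x - a) / c) ⁻¹' (𝒪[K] : Set K) := Set.ext fun x => mem_disc hc
  rw [this]
  exact isOpen_integers.preimage (by fun_prop)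

lemma disc_mem_nhds (a : K) {c : K} (hc : c ≠ 0) : disc a c ∈ 𝓝 a :=
  (isOpen_disc a hc).mem_nhds (self_mem_disc a c)

lemma eventually_disc_subset {x : K} {s : Set K} (hs : s ∈ 𝓝 x) :
    ∀ᶠ c in 𝓝 (0 : K), disc x c ⊆ s := by
  have hcont : Continuous fun cz : K × K => x + cz.1 * cz.2 := by fun_prop
  filter_upwards [isCompact_integers.eventually_forall_of_forall_eventually (x₀ := (0 : K))
    (P := fun c z => x + c * z ∈ s) fun z _ => hcont.continuousAt (by simpa using hs)] with c hc
  rintro _ ⟨z, hz, rfl⟩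
  exact hc z hz

variable {ϖ : 𝒪[K]}

lemma eventually_disc_pow_subset (hϖ : Irreducible ϖ) {x : K} {s : Set K} (hs : s ∈ 𝓝 x) :
    ∀ᶠ e : ℕ in atTop, disc x ((ϖ : K) ^ e) ⊆ s :=
  (tendsto_uniformizer_pow hϖ).eventually (eventually_disc_subset hs)

lemma hasBasis_nhds_disc (hϖ : Irreducible ϖ) (x : K) :
    (𝓝 x).HasBasis (fun _ : ℕ => True) fun e => disc x ((ϖ : K) ^ e) := by
  refine ⟨fun s => ⟨fun hs => ?_, fun ⟨e, _, h⟩ =>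
    mem_of_superset (disc_mem_nhds x (pow_ne_zero e (uniformizer_ne_zero hϖ))) h⟩⟩
  obtain ⟨e, he⟩ := (eventually_disc_pow_subset hϖ hs).exists
  exact ⟨e, trivial, he⟩

instance secondCountable : SecondCountableTopology K := by
  obtain ⟨ϖ, hϖ⟩ := IsDiscreteValuationRing.exists_irreducible 𝒪[K]
  let := IsTopologicalAddGroup.rightUniformSpace K
  have := isUniformAddGroup_of_addCommGroup (G := K)
  have : (𝓝 (0 : K)).IsCountablyGenerated := (hasBasis_nhds_disc hϖ 0).isCountablyGenerated
  have : (uniformity K).IsCountablyGenerated := IsUniformAddGroup.uniformity_countably_generated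
  let := TopologicalSpace.pseudoMetrizableSpacePseudoMetric K
  have : SigmaCompactSpace K := by
    refine ⟨⟨fun e : ℕ => disc 0 ((ϖ : K) ^ e)⁻¹, fun e => isCompact_disc _ _, ?_⟩⟩
    refine Set.eq_univ_of_forall fun x => Set.mem_iUnion.2 ?_
    have hx : Tendsto (fun e : ℕ => x * (ϖ : K) ^ e) atTop (𝓝 0) := by
      simpa using (tendsto_uniformizer_pow hϖ).const_mul x
    obtain ⟨e, he⟩ := (hx.eventually (isOpen_integers.mem_nhds (zero_mem 𝒪[K]))).exists
    exact ⟨e, (mem_disc (inv_ne_zero (pow_ne_zero e (uniformizer_ne_zero hϖ)))).2 (by simpa)⟩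
  infer_instance

lemma eventually_exists_mem_ideal {I : Ideal 𝒪[K]} (hI : I ≠ ⊥) :
    ∀ᶠ x in 𝓝 (0 : K), ∃ c ∈ I, x = (c : K) := by
  obtain ⟨c, hcI, hc⟩ := Submodule.exists_mem_ne_zero_of_ne_bot hI
  filter_upwards [disc_mem_nhds 0 (by simpa using hc : (c : K) ≠ 0)]
  rintro _ ⟨z, hz, rfl⟩
  exact ⟨c * ⟨z, hz⟩, I.mul_mem_right _ hcI, by simp⟩

lemma eventually_exists_principalUnit {I : Ideal 𝒪[K]} (hI : I ≠ ⊥) (hI' : I ≠ ⊤) {x : K}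
    (hx : x ≠ 0) : ∀ᶠ y in 𝓝 x, ∃ v ∈ principalUnits I, y = x * ((v : 𝒪[K]) : K) := by
  have hratio : Tendsto (fun y => y / x - 1) (𝓝 x) (𝓝 0) := by
    have hcont : Continuous fun y : K => y / x - 1 :=
      (continuous_id.div_const x).sub continuous_const
    simpa [hx] using hcont.tendsto x
  filter_upwards [hratio.eventually (eventually_exists_mem_ideal hI)]
  rintro y ⟨c, hc, hyc⟩
  obtain ⟨v, hv, hcv⟩ := exists_eq_mul_principalUnit hI' (x := 1 + c) (u := 1) (by simpa using hc)
  have hcvK : (1 : K) + c = (v : 𝒪[K]) := by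
    simpa using congrArg Subtype.val hcv
  refine ⟨v, hv, ?_⟩
  rw [← hcvK, ← hyc]
  field_simp
  ring

end Discs

section AbsVal

variable {K : Type*} [Field K] [ValuativeRel K] [TopologicalSpace K]
  [IsNonarchimedeanLocalField K]

variable (K) in
lemma one_lt_residueCard : 1 < residueCard K := Finite.one_lt_card

lemma absVal_of_ne_zero {x : K} (hx : x ≠ 0) : absVal x = (residueCard K : ℝ) ^ (-ord x) :=
  if_neg hx

lemma absVal_uniformizer_pow {ϖ : 𝒪[K]} (hϖ : Irreducible ϖ) (e : ℕ) :
    absVal ((ϖ : K) ^ e) = (residueCard K : ℝ)⁻¹ ^ e := by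
  have hord : ord ((ϖ : K) ^ e) = e := by
    simpa [ord_uniformizer hϖ] using ord_zpow (ϖ : K) e
  rw [absVal_of_ne_zero (pow_ne_zero e (uniformizer_ne_zero hϖ)), hord, zpow_neg, zpow_natCast,
    inv_pow]

lemma absVal_unit (u : (𝒪[K])ˣ) : absVal ((u : 𝒪[K]) : K) = 1 := by
  rw [absVal_of_ne_zero (by simp), ord_unit, neg_zero, zpow_zero]

end AbsVal

section Haar

variable {K : Type*} [Field K] [ValuativeRel K]

lemma disc_eq_integers {a : K} (ha : a ∈ 𝒪[K]) (u : (𝒪[K])ˣ) :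
    disc a ((u : 𝒪[K]) : K) = (𝒪[K] : Set K) := by
  refine (disc_subset_integers ha (u : 𝒪[K]).2).antisymm fun x hx => ?_
  refine ⟨((↑u⁻¹ : 𝒪[K]) : K) * (x - a), mul_mem (↑u⁻¹ : 𝒪[K]).2 (sub_mem hx ha), ?_⟩
  have h : ((u : 𝒪[K]) : K) * ((↑u⁻¹ : 𝒪[K]) : K) = 1 := congrArg Subtype.val u.mul_inv
  linear_combination (x - a) * h

lemma smul_integers_eq_disc (c : Kˣ) : c • (𝒪[K] : Set K) = disc 0 (c : K) := by
  simp [disc, Units.smul_def, ← Set.image_smul]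

variable [TopologicalSpace K] [IsNonarchimedeanLocalField K]

section

variable [MeasurableSpace K] (μ : Measure K) [μ.IsAddHaarMeasure]

lemma measure_integers_ne_zero : μ (𝒪[K] : Set K) ≠ 0 :=
  isOpen_integers.measure_ne_zero μ ⟨0, zero_mem 𝒪[K]⟩

variable [BorelSpace K]

lemma measurableSet_integers : MeasurableSet (𝒪[K] : Set K) :=
  isOpen_integers.measurableSet

lemma residueCard_mul_measure_disc_uniformizer {ϖ : 𝒪[K]} (hϖ : Irreducible ϖ) :
    residueCard K * μ (disc 0 (ϖ : K)) = μ (𝒪[K] : Set K) := by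
  have hval : MeasurableEmbedding ((↑) : 𝒪[K] → K) := .subtype_coe measurableSet_integers
  have : (μ.comap ((↑) : 𝒪[K] → K)).IsAddLeftInvariant :=
    Measure.IsAddLeftInvariant.comap μ (f := (𝒪[K]).subtype.toAddMonoidHom) hval
  let H : AddSubgroup 𝒪[K] := (maximalIdeal 𝒪[K]).toAddSubgroup
  have himage : ((↑) : 𝒪[K] → K) '' H = disc 0 (ϖ : K) := by
    have hH : (H : Set 𝒪[K]) = Set.range (ϖ * ·) := by
      ext x
      simp [H, hϖ.maximalIdeal_eq, Ideal.mem_span_singleton, dvd_def, eq_comm]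
    rw [hH, ← Set.range_comp, disc, Set.image_eq_range]
    simp [Function.comp_def]
  have hopen : MeasurableSet (H : Set 𝒪[K]) := by
    rw [← hval.measurableSet_image, himage]
    exact (isOpen_disc 0 (uniformizer_ne_zero hϖ)).measurableSet
  have hfin : H.FiniteIndex :=
    AddSubgroup.finiteIndex_iff_finite_quotient.2 (inferInstanceAs (Finite 𝓀[K]))
  have h := AddSubgroup.index_mul_measure H hopen (μ.comap (↑))
  rwa [hval.comap_apply, hval.comap_apply, himage, Set.image_univ, Subtype.range_coe] at h

end

lemma distribHaarChar_uniformizer {ϖ : 𝒪[K]} (hϖ : Irreducible ϖ) :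
    distribHaarChar K (Units.mk0 (ϖ : K) (uniformizer_ne_zero hϖ)) = (residueCard K : ℝ≥0)⁻¹ := by
  borelize K
  have hfin : (Measure.addHaar : Measure K) (𝒪[K] : Set K) ≠ ⊤ :=
    isCompact_integers.measure_lt_top.ne
  have hq : (residueCard K : ENNReal) ≠ 0 := by
    simpa using (zero_lt_one.trans (one_lt_residueCard K)).ne'
  refine distribHaarChar_eq_of_measure_smul_eq_mul (measure_integers_ne_zero .addHaar) hfin ?_
  rw [smul_integers_eq_disc, Units.val_mk0, ← residueCard_mul_measure_disc_uniformizer _ hϖ,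
    ← mul_assoc, ENNReal.coe_inv (by simpa using hq), ENNReal.coe_natCast,
    ENNReal.inv_mul_cancel hq (by simp), one_mul]

lemma distribHaarChar_unit (u : (𝒪[K])ˣ) :
    distribHaarChar K (Units.map (𝒪[K]).subtype.toMonoidHom u) = 1 := by
  borelize K
  have hfin : (Measure.addHaar : Measure K) (𝒪[K] : Set K) ≠ ⊤ :=
    isCompact_integers.measure_lt_top.ne
  refine distribHaarChar_eq_of_measure_smul_eq_mul (measure_integers_ne_zero .addHaar) hfin ?_
  rw [smul_integers_eq_disc, ENNReal.coe_one, one_mul]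
  exact congrArg _ (disc_eq_integers (zero_mem _) u)

lemma distribHaarChar_eq_absVal (c : Kˣ) : (distribHaarChar K c : ℝ) = absVal (c : K) := by
  obtain ⟨ϖ, hϖ⟩ := IsDiscreteValuationRing.exists_irreducible 𝒪[K]
  obtain ⟨u, hu⟩ := exists_eq_unit_mul_zpow hϖ c.ne_zero
  have hc : c = Units.map (𝒪[K]).subtype.toMonoidHom u *
      Units.mk0 (ϖ : K) (uniformizer_ne_zero hϖ) ^ ord (c : K) :=
    Units.ext (by simpa using hu)
  conv_lhs => rw [hc]
  rw [map_mul, map_zpow, distribHaarChar_unit, distribHaarChar_uniformizer hϖ,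
    absVal_of_ne_zero c.ne_zero]
  simp

variable [MeasurableSpace K] [BorelSpace K] (μ : Measure K) [μ.IsAddHaarMeasure]

lemma setIntegral_disc (a : K) {c : K} (hc : c ≠ 0) (φ : K → ℂ) :
    ∫ x in disc a c, φ x ∂μ = absVal c * ∫ z in (𝒪[K] : Set K), φ (a + c * z) ∂μ := by
  let A : K ≃ₜ K := (Homeomorph.mulLeft₀ c hc).trans (Homeomorph.addLeft a)
  have hmap : distribHaarChar K (Units.mk0 c hc) • μ.map A = μ := by
    refine Measure.ext fun s hs => ?_
    have hsmul : Units.mk0 c hc • A ⁻¹' s = (fun x => a + x) ⁻¹' s := by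
      ext x
      rw [Set.mem_smul_set_iff_inv_smul_mem]
      simp [A, Units.smul_def, mul_inv_cancel_left₀ hc]
    rw [Measure.smul_apply, Measure.map_apply (by fun_prop) hs, ENNReal.smul_def, smul_eq_mul,
      distribHaarChar_mul, hsmul, measure_preimage_add]
  have hpre : A ⁻¹' disc a c = (𝒪[K] : Set K) :=
    A.injective.preimage_image _
  calc ∫ x in disc a c, φ x ∂μ
      = distribHaarChar K (Units.mk0 c hc) • ∫ x in disc a c, φ x ∂μ.map A := by
        conv_lhs => rw [← hmap, Measure.restrict_smul, integral_smul_nnreal_measure]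
    _ = absVal c * ∫ z in (𝒪[K] : Set K), φ (a + c * z) ∂μ := by
        rw [A.measurableEmbedding.setIntegral_map, hpre, NNReal.smul_def,
          distribHaarChar_eq_absVal, Units.val_mk0, Complex.real_smul]
        rfl

lemma setIntegral_disc_pow {ϖ : 𝒪[K]} (hϖ : Irreducible ϖ) (a : K) (e : ℕ) (φ : K → ℂ) :
    ∫ x in disc a ((ϖ : K) ^ e), φ x ∂μ
      = (residueCard K : ℂ)⁻¹ ^ e * ∫ z in (𝒪[K] : Set K), φ (a + (ϖ : K) ^ e * z) ∂μ := by
  rw [setIntegral_disc μ a (pow_ne_zero e (uniformizer_ne_zero hϖ)), absVal_uniformizer_pow hϖ]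
  push_cast
  rfl

lemma setIntegral_integers_comp_affine {a : K} (ha : a ∈ 𝒪[K]) (u : (𝒪[K])ˣ) (φ : K → ℂ) :
    ∫ z in (𝒪[K] : Set K), φ (a + ((u : 𝒪[K]) : K) * z) ∂μ
      = ∫ z in (𝒪[K] : Set K), φ z ∂μ := by
  have h := setIntegral_disc μ a (c := ((u : 𝒪[K]) : K)) (by simp) φ
  rw [disc_eq_integers ha, absVal_unit, Complex.ofReal_one, one_mul] at h
  exact h.symm

lemma setIntegral_integers_add_left {a : K} (ha : a ∈ 𝒪[K]) (φ : K → ℂ) :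
    ∫ z in (𝒪[K] : Set K), φ (a + z) ∂μ = ∫ z in (𝒪[K] : Set K), φ z ∂μ := by
  simpa using setIntegral_integers_comp_affine μ ha 1 φ

lemma setIntegral_integers_unit_mul (u : (𝒪[K])ˣ) (φ : K → ℂ) :
    ∫ z in (𝒪[K] : Set K), φ (((u : 𝒪[K]) : K) * z) ∂μ = ∫ z in (𝒪[K] : Set K), φ z ∂μ := by
  simpa using setIntegral_integers_comp_affine μ (zero_mem 𝒪[K]) u φ

end Haar

section RationalFunctions

/-- The punctured open unit disc, in which `t = q ^ (-s)` ranges for `Re s > 0`. -/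
abbrev PuncturedDisc : Type := {t : ℂ // t ≠ 0 ∧ ‖t‖ < 1}

/-- The functions `G / D` of `t` on the punctured unit disc, with `G` a polynomial. The
denominator is cleared in the definition, so that no condition on the zeros of `D` is needed. -/
def rationalWithDenom (D : ℂ[X]) : Submodule ℂ (PuncturedDisc → ℂ) where
  carrier := {φ | ∃ G : ℂ[X], ∀ t : PuncturedDisc, D.eval (t : ℂ) * φ t = G.eval (t : ℂ)}
  add_mem' := by
    rintro φ ψ ⟨G, hG⟩ ⟨H, hH⟩
    exact ⟨G + H, fun t => by simp [mul_add, hG, hH]⟩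
  zero_mem' := ⟨0, fun t => by simp⟩
  smul_mem' := by
    rintro c φ ⟨G, hG⟩
    exact ⟨C c * G, fun t => by simp [← hG, mul_left_comm]⟩

lemma rationalWithDenom_mono {D D' : ℂ[X]} (h : D ∣ D') :
    rationalWithDenom D ≤ rationalWithDenom D' := by
  obtain ⟨E, rfl⟩ := h
  rintro φ ⟨G, hG⟩
  exact ⟨G * E, fun t => by simp [← hG, mul_right_comm]⟩

lemma eval_mul_mem_rationalWithDenom {D : ℂ[X]} {φ : PuncturedDisc → ℂ}
    (hφ : φ ∈ rationalWithDenom D) (P : ℂ[X]) :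
    (fun t : PuncturedDisc => P.eval (t : ℂ) * φ t) ∈ rationalWithDenom D := by
  obtain ⟨G, hG⟩ := hφ
  exact ⟨P * G, fun t => by simp [← hG, mul_left_comm]⟩

lemma eval_mem_rationalWithDenom (D P : ℂ[X]) :
    (fun t : PuncturedDisc => P.eval (t : ℂ)) ∈ rationalWithDenom D :=
  ⟨D * P, fun t => by simp⟩

lemma mem_rationalWithDenom_mul {D E : ℂ[X]} {φ : PuncturedDisc → ℂ}
    (h : (fun t : PuncturedDisc => E.eval (t : ℂ) * φ t) ∈ rationalWithDenom D) :
    φ ∈ rationalWithDenom (D * E) := by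
  obtain ⟨G, hG⟩ := h
  exact ⟨G, fun t => by simp [← hG, mul_assoc]⟩

end RationalFunctions

section LocalToGlobal

variable {K : Type*} [Field K] [ValuativeRel K] {ϖ : 𝒪[K]}

lemma disc_subset_or_disjoint (a b : K) {e k : ℕ} (h : e ≤ k) :
    disc b ((ϖ : K) ^ k) ⊆ disc a ((ϖ : K) ^ e) ∨
      Disjoint (disc b ((ϖ : K) ^ k)) (disc a ((ϖ : K) ^ e)) := by
  refine or_iff_not_imp_right.2 fun hdisj => ?_
  obtain ⟨_, ⟨z, hz, rfl⟩, w, hw, hzw⟩ := Set.not_disjoint_iff.1 hdisj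
  rintro _ ⟨y, hy, rfl⟩
  refine ⟨w + (ϖ : K) ^ (k - e) * (y - z),
    add_mem hw (mul_mem (pow_mem ϖ.2 _) (sub_mem hy hz)), ?_⟩
  have hpow : (ϖ : K) ^ e * (ϖ : K) ^ (k - e) = (ϖ : K) ^ k := pow_mul_pow_sub _ h
  simp only at hzw ⊢
  linear_combination hzw + (y - z) * hpow

variable [TopologicalSpace K] [IsNonarchimedeanLocalField K]

lemma exists_disjoint_disc_cover (hϖ : Irreducible ϖ) {S : Set K} (hS : IsCompact S)
    (hSo : IsOpen S) {P : K → ℕ → Prop} (hP : ∀ x ∈ S, ∀ᶠ e in atTop, P x e) :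
    ∃ 𝒟 : Finset (Set K), (𝒟 : Set (Set K)).PairwiseDisjoint id ∧ S = ⋃ D ∈ 𝒟, D ∧
      ∀ D ∈ 𝒟, ∃ x ∈ S, ∃ e, P x e ∧ D = disc x ((ϖ : K) ^ e) := by
  classical
  have hsmall : ∀ x ∈ S, ∃ e, P x e ∧ disc x ((ϖ : K) ^ e) ⊆ S := fun x hx =>
    ((hP x hx).and (eventually_disc_pow_subset hϖ (hSo.mem_nhds hx))).exists
  choose! e he using hsmall
  obtain ⟨T, hTS, hST⟩ := hS.elim_nhds_subcover (fun x => disc x ((ϖ : K) ^ e x)) fun x _ =>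
    disc_mem_nhds x (pow_ne_zero _ (uniformizer_ne_zero hϖ))
  set ℱ := T.image fun x => disc x ((ϖ : K) ^ e x) with hℱ
  have hlaminar : ∀ D ∈ ℱ, ∀ E ∈ ℱ, D ⊆ E ∨ E ⊆ D ∨ Disjoint D E := by
    simp only [hℱ, Finset.forall_mem_image]
    intro x _ y _
    rcases le_total (e x) (e y) with h | h
    · exact .inr ((disc_subset_or_disjoint x y h).imp_right (·.symm))
    · exact (disc_subset_or_disjoint y x h).imp_right .inr
  refine ⟨ℱ.filter fun D => Maximal (· ∈ ℱ) D, ?_, Set.Subset.antisymm ?_ ?_, ?_⟩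
  · intro D hD E hE hDE
    obtain ⟨hD, hDmax⟩ := Finset.mem_filter.1 hD
    obtain ⟨hE, hEmax⟩ := Finset.mem_filter.1 hE
    rcases hlaminar D hD E hE with h | h | h
    · exact (hDE (hDmax.eq_of_le hE h)).elim
    · exact (hDE (hEmax.eq_of_le hD h).symm).elim
    · exact h
  · intro y hy
    obtain ⟨x, hx, hyx⟩ := Set.mem_iUnion₂.1 (hST hy)
    obtain ⟨D, hxD, hD⟩ := ℱ.exists_le_maximal (Finset.mem_image_of_mem _ hx)
    exact Set.mem_biUnion (Finset.mem_filter.2 ⟨hD.prop, hD⟩) (hxD hyx)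
  · simp only [Set.iUnion_subset_iff, Finset.mem_filter, hℱ, and_imp, Finset.forall_mem_image]
    exact fun x hx _ => (he x (hTS x hx)).2
  · simp only [Finset.mem_filter, hℱ, and_imp, Finset.forall_mem_image]
    exact fun x hx _ => ⟨x, hTS x hx, e x, (he x (hTS x hx)).1, rfl⟩

variable [MeasurableSpace K] [BorelSpace K] (μ : Measure K)
  {ι : Type*} (W : Submodule ℂ (ι → ℂ)) {Φ : K → ι → ℂ}

lemma setIntegral_mem_of_eventually_disc_mem (hϖ : Irreducible ϖ) {S : Set K} (hS : IsCompact S)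
    (hSo : IsOpen S) (hint : ∀ i, IntegrableOn (fun x => Φ x i) S μ)
    (hloc : ∀ x ∈ S, ∀ᶠ e in atTop, (fun i => ∫ y in disc x ((ϖ : K) ^ e), Φ y i ∂μ) ∈ W) :
    (fun i => ∫ x in S, Φ x i ∂μ) ∈ W := by
  obtain ⟨𝒟, hdisj, hcover, h𝒟⟩ := exists_disjoint_disc_cover hϖ hS hSo hloc
  have hsum : (fun i => ∫ x in S, Φ x i ∂μ) = ∑ D ∈ 𝒟, fun i => ∫ x in D, Φ x i ∂μ := by
    ext i
    rw [Finset.sum_apply, hcover]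
    refine integral_biUnion_finset 𝒟 (fun D hD => ?_) hdisj fun D hD => (hint i).mono_set ?_
    · obtain ⟨x, _, e, _, rfl⟩ := h𝒟 D hD
      exact (isOpen_disc x (pow_ne_zero e (uniformizer_ne_zero hϖ))).measurableSet
    · exact hcover ▸ Set.subset_biUnion_of_mem (u := fun D => D) hD
  rw [hsum]
  refine W.sum_mem fun D hD => ?_
  obtain ⟨x, _, e, hmem, rfl⟩ := h𝒟 D hD
  exact hmem

lemma eventually_setIntegral_disc_mem (hϖ : Irreducible ϖ) {x : K}
    (hconst : ∀ᶠ y in 𝓝 x, Φ y = Φ x) (hx : Φ x ∈ W) :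
    ∀ᶠ e in atTop, (fun i => ∫ y in disc x ((ϖ : K) ^ e), Φ y i ∂μ) ∈ W := by
  filter_upwards [eventually_disc_pow_subset hϖ hconst] with e he
  have hint : (fun i => ∫ y in disc x ((ϖ : K) ^ e), Φ y i ∂μ)
      = (μ.real (disc x ((ϖ : K) ^ e)) : ℂ) • Φ x := by
    ext i
    rw [setIntegral_congr_fun (isOpen_disc x (pow_ne_zero e (uniformizer_ne_zero hϖ))).measurableSet
      fun y hy => congrFun (he hy) i, setIntegral_const]
    simp
  rw [hint]
  exact W.smul_mem _ hx

end LocalToGlobal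

section QuasiCharacters

/-- `ℂˣ` has no small subgroups: close to `1`, squaring increases the distance to `1` by a factor
of at least `3 / 2`. -/
lemma eq_one_of_forall_norm_pow_two_pow_sub_one_lt {z : ℂ}
    (h : ∀ k : ℕ, ‖z ^ 2 ^ k - 1‖ < 1 / 2) : z = 1 := by
  by_contra hz
  have hpos : 0 < ‖z - 1‖ := norm_pos_iff.2 (sub_ne_zero.2 hz)
  have hgrow (k : ℕ) : (3 / 2 : ℝ) ^ k * ‖z - 1‖ ≤ ‖z ^ 2 ^ k - 1‖ := by
    induction k with
    | zero => simp
    | succ k ih =>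
      set w := z ^ 2 ^ k
      have hfactor : z ^ 2 ^ (k + 1) - 1 = (2 + (w - 1)) * (w - 1) := by
        simp only [w, pow_succ, pow_mul]
        ring
      have hfar : (3 / 2 : ℝ) ≤ ‖2 + (w - 1)‖ := by
        have htri := norm_sub_le_norm_add (2 : ℂ) (w - 1)
        have hnear : ‖w - 1‖ < 1 / 2 := h k
        norm_num at htri
        linarith
      rw [hfactor, norm_mul, pow_succ', mul_assoc]
      gcongr
  obtain ⟨k, hk⟩ := pow_unbounded_of_one_lt (‖z - 1‖)⁻¹ (by norm_num : (1 : ℝ) < 3 / 2)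
  have hlarge : 1 < (3 / 2 : ℝ) ^ k * ‖z - 1‖ := by
    rwa [inv_lt_iff_one_lt_mul₀ hpos] at hk
  linarith [hgrow k, h k]

variable {K : Type*} [Field K] [ValuativeRel K] [TopologicalSpace K]
  [IsNonarchimedeanLocalField K] {ϖ : 𝒪[K]} {χ : (𝒪[K])ˣ →* ℂˣ}

lemma isClosedEmbedding_units_coe :
    IsClosedEmbedding fun u : (𝒪[K])ˣ => ((u : 𝒪[K]) : K) := by
  have : CompactSpace 𝒪[K] := inferInstance
  refine Continuous.isClosedEmbedding (by fun_prop) ?_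
  exact Subtype.val_injective.comp Units.val_injective

lemma exists_principalUnits_le_ker (hχ : Continuous χ) :
    ∃ I : Ideal 𝒪[K], I ≠ ⊥ ∧ I ≠ ⊤ ∧ principalUnits I ≤ χ.ker := by
  obtain ⟨ϖ, hϖ⟩ := IsDiscreteValuationRing.exists_irreducible 𝒪[K]
  have hnear : ∀ᶠ u in 𝓝 (1 : (𝒪[K])ˣ), ‖(χ u : ℂ) - 1‖ < 1 / 2 := by
    have hcont : Continuous fun u => ‖(χ u : ℂ) - 1‖ := by fun_prop
    exact hcont.continuousAt.eventually_lt continuousAt_const (by simp)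
  rw [isClosedEmbedding_units_coe.isInducing.nhds_eq_comap, eventually_comap] at hnear
  obtain ⟨e, he, he1⟩ :=
    ((eventually_disc_pow_subset hϖ hnear).and (eventually_ge_atTop 1)).exists
  refine ⟨Ideal.span {ϖ ^ e}, by simpa using fun h => absurd h hϖ.ne_zero, ?_, fun u hu => ?_⟩
  · rw [Ne, Ideal.span_singleton_eq_top, isUnit_pow_iff (by omega)]
    exact hϖ.not_isUnit
  refine Units.ext (eq_one_of_forall_norm_pow_two_pow_sub_one_lt fun k => ?_)
  obtain ⟨z, hz⟩ := Ideal.mem_span_singleton.1 (mem_principalUnits.1 (pow_mem hu (2 ^ k)))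
  have hmem : (((u ^ 2 ^ k : (𝒪[K])ˣ) : 𝒪[K]) : K) ∈ disc 1 ((ϖ : K) ^ e) :=
    ⟨z, z.2, by rw [sub_eq_iff_eq_add'.1 hz]; rfl⟩
  simpa only [map_pow, Units.val_pow_eq_pow_val] using he hmem (u ^ 2 ^ k) rfl

lemma exists_norm_char_le (hχ : Continuous χ) : ∃ B : ℝ, ∀ u : (𝒪[K])ˣ, ‖(χ u : ℂ)‖ ≤ B := by
  have : CompactSpace (𝒪[K])ˣ := inferInstance
  obtain ⟨B, hB⟩ := isCompact_univ.exists_bound_of_continuousOn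
    (f := fun u => (χ u : ℂ)) (by fun_prop)
  exact ⟨B, fun u => hB u (Set.mem_univ u)⟩

lemma charAC_unit_mul_zpow (hϖ : Irreducible ϖ) (u : (𝒪[K])ˣ) (k : ℤ) :
    charAC ϖ χ (((u : 𝒪[K]) : K) * (ϖ : K) ^ k) = χ u := by
  have hϖ0 := uniformizer_ne_zero hϖ
  have hx : ((u : 𝒪[K]) : K) * (ϖ : K) ^ k ≠ 0 := mul_ne_zero (by simp) (zpow_ne_zero k hϖ0)
  have hord : ord (((u : 𝒪[K]) : K) * (ϖ : K) ^ k) = k := by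
    rw [ord_mul (by simp) (zpow_ne_zero k hϖ0), ord_unit, ord_zpow, ord_uniformizer hϖ]
    ring
  have hexists := exists_eq_unit_mul_zpow hϖ hx
  rw [charAC, dif_pos hexists,
    (existsUnique_angular hϖ hx).unique hexists.choose_spec (by rw [hord])]

/-- The quasi-character `x ↦ χ (ac x) t ^ ord x` of `Kˣ`, extended by zero. With `t = q ^ (-s)` it
is the integrand `χ (ac x) |x| ^ s`. -/
noncomputable def quasiChar (hϖ : Irreducible ϖ) (χ : (𝒪[K])ˣ →* ℂˣ) (t : PuncturedDisc) :
    K →*₀ ℂ where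
  toFun x := charAC ϖ χ x * (t : ℂ) ^ ord x
  map_zero' := by rw [charAC_zero ϖ hϖ, zero_mul]
  map_one' := by
    have hord : ord (1 : K) = 0 := ord_unit 1
    simpa [hord] using charAC_unit_mul_zpow (χ := χ) hϖ 1 0
  map_mul' x y := by
    rcases eq_or_ne x 0 with rfl | hx
    · simp [charAC_zero ϖ hϖ]
    rcases eq_or_ne y 0 with rfl | hy
    · simp [charAC_zero ϖ hϖ]
    obtain ⟨u, hu⟩ := exists_eq_unit_mul_zpow hϖ hx
    obtain ⟨v, hv⟩ := exists_eq_unit_mul_zpow hϖ hy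
    have huv : x * y = (((u * v : (𝒪[K])ˣ) : 𝒪[K]) : K) * (ϖ : K) ^ (ord x + ord y) := by
      conv_lhs => rw [hu, hv]
      rw [zpow_add₀ (uniformizer_ne_zero hϖ)]
      push_cast
      ring
    have hcharAC : charAC ϖ χ (x * y) = charAC ϖ χ x * charAC ϖ χ y := by
      rw [huv, charAC_unit_mul_zpow hϖ]
      conv_rhs => rw [hu, hv, charAC_unit_mul_zpow hϖ, charAC_unit_mul_zpow hϖ]
      simp
    rw [hcharAC, ord_mul hx hy, zpow_add₀ t.2.1]
    ring

variable (hϖ : Irreducible ϖ) (t : PuncturedDisc)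

lemma quasiChar_apply (χ : (𝒪[K])ˣ →* ℂˣ) (x : K) :
    quasiChar hϖ χ t x = charAC ϖ χ x * (t : ℂ) ^ ord x := rfl

lemma quasiChar_uniformizer (χ : (𝒪[K])ˣ →* ℂˣ) : quasiChar hϖ χ t (ϖ : K) = t := by
  have hac : charAC ϖ χ (ϖ : K) = 1 := by simpa using charAC_unit_mul_zpow (χ := χ) hϖ 1 1
  rw [quasiChar_apply, hac, ord_uniformizer hϖ, zpow_one, one_mul]

lemma quasiChar_unit (u : (𝒪[K])ˣ) : quasiChar hϖ χ t ((u : 𝒪[K]) : K) = χ u := by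
  have hac : charAC ϖ χ ((u : 𝒪[K]) : K) = χ u := by
    simpa using charAC_unit_mul_zpow (χ := χ) hϖ u 0
  rw [quasiChar_apply, hac, ord_unit, zpow_zero, mul_one]

lemma quasiChar_eq_one {v : (𝒪[K])ˣ} (hv : v ∈ χ.ker) :
    quasiChar hϖ χ t ((v : 𝒪[K]) : K) = 1 := by
  rw [quasiChar_unit, MonoidHom.mem_ker.1 hv, Units.val_one]

lemma exists_norm_quasiChar_le (hχ : Continuous χ) :
    ∃ B : ℝ, ∀ t, ∀ x ∈ 𝒪[K], ‖quasiChar hϖ χ t x‖ ≤ B := by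
  obtain ⟨B, hB⟩ := exists_norm_char_le hχ
  refine ⟨B, fun t x hx => ?_⟩
  rcases eq_or_ne x 0 with rfl | hx0
  · simpa using (norm_nonneg _).trans (hB 1)
  obtain ⟨u, hu⟩ := exists_eq_unit_mul_zpow hϖ hx0
  obtain ⟨k, hk⟩ := Int.eq_ofNat_of_zero_le ((ord_nonneg_iff hx0).2 hx)
  rw [hu, map_mul, quasiChar_unit, map_zpow₀, quasiChar_uniformizer, hk, zpow_natCast, norm_mul,
    norm_pow]
  calc ‖(χ u : ℂ)‖ * ‖(t : ℂ)‖ ^ k ≤ ‖(χ u : ℂ)‖ * 1 := by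
        gcongr
        exact pow_le_one₀ (norm_nonneg _) t.2.2.le
    _ ≤ B := by simpa using hB u

lemma eventually_quasiChar_eq (hχ : Continuous χ) {x : K} (hx : x ≠ 0) :
    ∀ᶠ y in 𝓝 x, ∀ t, quasiChar hϖ χ t y = quasiChar hϖ χ t x := by
  obtain ⟨I, hI, hI', hIχ⟩ := exists_principalUnits_le_ker hχ
  filter_upwards [eventually_exists_principalUnit hI hI' hx]
  rintro _ ⟨v, hv, rfl⟩ t
  rw [map_mul, quasiChar_eq_one hϖ t (hIχ hv), mul_one]

lemma eventually_quasiChar_comp_eq (hχ : Continuous χ) {X : Type*} [TopologicalSpace X] {g : X → K}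
    {x : X} (hg : ContinuousAt g x) (hx : g x ≠ 0) :
    ∀ᶠ y in 𝓝 x, (fun t => quasiChar hϖ χ t (g y)) = fun t => quasiChar hϖ χ t (g x) := by
  filter_upwards [hg.eventually (eventually_quasiChar_eq hϖ hχ hx)] with y hy
  exact funext hy

lemma quasiChar_mem_rationalWithDenom (χ : (𝒪[K])ˣ →* ℂˣ) (D : ℂ[X]) {x : K} (hx : x ∈ 𝒪[K]) :
    (fun t => quasiChar hϖ χ t x) ∈ rationalWithDenom D := by
  rcases eq_or_ne x 0 with rfl | hx0
  · simp only [map_zero]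
    exact (rationalWithDenom D).zero_mem
  obtain ⟨k, hk⟩ := Int.eq_ofNat_of_zero_le ((ord_nonneg_iff hx0).2 hx)
  convert eval_mem_rationalWithDenom D (C (charAC ϖ χ x) * X ^ k) using 2 with t
  simp [quasiChar_apply, hk]

variable [MeasurableSpace K] [BorelSpace K]

lemma measurable_quasiChar (hχ : Continuous χ) : Measurable (quasiChar hϖ χ t) := by
  refine measurable_of_continuousOn_compl_singleton 0 fun x hx => ?_
  refine ContinuousAt.continuousWithinAt ?_
  have hconst : (fun _ => quasiChar hϖ χ t x) =ᶠ[𝓝 x] quasiChar hϖ χ t :=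
    (eventually_quasiChar_eq hϖ hχ hx).mono fun y hy => (hy t).symm
  exact continuousAt_const.congr hconst

lemma integrableOn_quasiChar_comp (hχ : Continuous χ) {X : Type*} [MeasurableSpace X]
    {ν : Measure X} {S : Set X} (hS : MeasurableSet S) (hν : ν S ≠ ⊤) {g : X → K}
    (hg : Measurable g) (hgS : ∀ x ∈ S, g x ∈ 𝒪[K]) :
    IntegrableOn (fun x => quasiChar hϖ χ t (g x)) S ν := by
  obtain ⟨B, hB⟩ := exists_norm_quasiChar_le hϖ hχ
  refine IntegrableOn.of_bound hν.lt_top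
    ((measurable_quasiChar hϖ t hχ).comp hg).aestronglyMeasurable B ?_
  exact (ae_restrict_mem hS).mono fun x hx => hB t _ (hgS x hx)

end QuasiCharacters

section SelfSimilarity

/-- The polynomial `1 - q ^ (-a) X ^ b`. At `X = q ^ (-s)` it is the factor `1 - q ^ (-a - b s)` of
the denominator of a zeta function. -/
noncomputable def denomFactor (q a b : ℕ) : ℂ[X] := 1 - C ((q : ℂ)⁻¹ ^ a) * X ^ b

lemma eval_denomFactor (q a b : ℕ) (t : ℂ) :
    (denomFactor q a b).eval t = 1 - (q : ℂ)⁻¹ ^ a * t ^ b := by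
  simp [denomFactor]

variable {K : Type*} [Field K] [ValuativeRel K] [TopologicalSpace K]
  [IsNonarchimedeanLocalField K] [MeasurableSpace K] [BorelSpace K]
  (μ : Measure K) {ϖ : 𝒪[K]} (hϖ : Irreducible ϖ)

include hϖ

lemma setIntegral_integers_diff_disc_mem {ι : Type*} (W : Submodule ℂ (ι → ℂ)) {Φ : K → ι → ℂ}
    (hint : ∀ i, IntegrableOn (fun x => Φ x i) (𝒪[K] : Set K) μ)
    (hconst : ∀ x ∈ 𝒪[K], x ≠ 0 → ∀ᶠ y in 𝓝 x, Φ y = Φ x)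
    (hmem : ∀ x ∈ 𝒪[K], x ≠ 0 → Φ x ∈ W) (e : ℕ) :
    (fun i => ∫ x in (𝒪[K] : Set K) \ disc 0 ((ϖ : K) ^ e), Φ x i ∂μ) ∈ W := by
  have hopen := isOpen_disc (0 : K) (pow_ne_zero e (uniformizer_ne_zero hϖ))
  refine setIntegral_mem_of_eventually_disc_mem μ W hϖ (isCompact_integers.diff hopen)
    (isOpen_integers.sdiff (isCompact_disc _ _).isClosed)
    (fun i => (hint i).mono_set Set.sdiff_subset) fun x hx => ?_
  have hx0 : x ≠ 0 := by
    rintro rfl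
    exact hx.2 (self_mem_disc _ _)
  exact eventually_setIntegral_disc_mem μ W hϖ (hconst x hx.1 hx0) (hmem x hx.1 hx0)

variable [μ.IsAddHaarMeasure]

lemma setIntegral_integers_eq_add (e : ℕ) {φ : K → ℂ} (hφ : IntegrableOn φ (𝒪[K] : Set K) μ) :
    ∫ x in (𝒪[K] : Set K), φ x ∂μ = ∫ x in (𝒪[K] : Set K) \ disc 0 ((ϖ : K) ^ e), φ x ∂μ
      + (residueCard K : ℂ)⁻¹ ^ e * ∫ x in (𝒪[K] : Set K), φ ((ϖ : K) ^ e * x) ∂μ := by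
  have hsub : disc 0 ((ϖ : K) ^ e) ⊆ (𝒪[K] : Set K) :=
    disc_subset_integers (zero_mem _) (pow_mem ϖ.2 e)
  have hdisc := setIntegral_disc_pow μ hϖ 0 e φ
  simp only [zero_add] at hdisc
  rw [← hdisc, ← setIntegral_union Set.disjoint_sdiff_left
    (isOpen_disc 0 (pow_ne_zero e (uniformizer_ne_zero hϖ))).measurableSet
    (hφ.mono_set Set.sdiff_subset) (hφ.mono_set hsub), Set.sdiff_union_of_subset hsub]

/-- Splitting off the disc `ϖ ^ e 𝒪` gives a linear equation for the integral over `𝒪`. -/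
lemma setIntegral_mem_of_self_similar {D : ℂ[X]} {Φ : K → PuncturedDisc → ℂ}
    (hint : ∀ t, IntegrableOn (fun x => Φ x t) (𝒪[K] : Set K) μ)
    (hconst : ∀ x ∈ 𝒪[K], x ≠ 0 → ∀ᶠ y in 𝓝 x, Φ y = Φ x)
    (hmem : ∀ x ∈ 𝒪[K], x ≠ 0 → Φ x ∈ rationalWithDenom D) {e a b : ℕ} {P : ℂ[X]}
    (hsim : ∀ x ∈ 𝒪[K], ∀ t : PuncturedDisc, Φ ((ϖ : K) ^ e * x) t
      = P.eval (t : ℂ) + (residueCard K : ℂ)⁻¹ ^ a * (t : ℂ) ^ b * Φ x t) :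
    (fun t => ∫ x in (𝒪[K] : Set K), Φ x t ∂μ)
      ∈ rationalWithDenom (D * denomFactor (residueCard K) (e + a) b) := by
  refine mem_rationalWithDenom_mul ?_
  convert (rationalWithDenom D).add_mem
    (setIntegral_integers_diff_disc_mem μ hϖ _ hint hconst hmem e)
    (eval_mem_rationalWithDenom D
      (C ((residueCard K : ℂ)⁻¹ ^ e * (μ.real (𝒪[K] : Set K) : ℂ)) * P)) using 1
  ext t
  have hP : IntegrableOn (fun _ => P.eval (t : ℂ)) (𝒪[K] : Set K) μ :=
    integrableOn_const isCompact_integers.measure_lt_top.ne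
  have hscaled : ∫ x in (𝒪[K] : Set K), Φ ((ϖ : K) ^ e * x) t ∂μ
      = (μ.real (𝒪[K] : Set K) : ℂ) * P.eval (t : ℂ)
        + (residueCard K : ℂ)⁻¹ ^ a * (t : ℂ) ^ b * ∫ x in (𝒪[K] : Set K), Φ x t ∂μ := by
    rw [setIntegral_congr_fun measurableSet_integers fun x hx => hsim x hx t,
      integral_add hP ((hint t).const_mul _), integral_const_mul,
      setIntegral_const, Complex.real_smul]
  have hsplit := setIntegral_integers_eq_add μ hϖ e (hint t)
  rw [hscaled] at hsplit
  simp only [eval_denomFactor, Pi.add_apply, eval_mul, eval_C]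
  linear_combination hsplit

variable {χ : (𝒪[K])ˣ →* ℂˣ} (hχ : Continuous χ)

include hχ

lemma setIntegral_quasiChar_mem :
    (fun t => ∫ x in (𝒪[K] : Set K), quasiChar hϖ χ t x ∂μ)
      ∈ rationalWithDenom (denomFactor (residueCard K) 1 1) := by
  simpa only [one_mul] using setIntegral_mem_of_self_similar μ hϖ (D := 1)
    (Φ := fun x t => quasiChar hϖ χ t x) (e := 1) (a := 0) (b := 1) (P := 0)
    (fun t => integrableOn_quasiChar_comp hϖ t hχ measurableSet_integers
      isCompact_integers.measure_lt_top.ne measurable_id fun x hx => hx)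
    (fun x _ hx => eventually_quasiChar_comp_eq hϖ hχ continuousAt_id hx)
    (fun x hx _ => quasiChar_mem_rationalWithDenom hϖ χ 1 hx)
    fun x _ t => by simp [quasiChar_uniformizer]

lemma setIntegral_disc_quasiChar_mem (a : K) {b : K} (hb : b ∈ 𝒪[K]) (e : ℕ) :
    (fun t => ∫ x in disc a ((ϖ : K) ^ e), quasiChar hϖ χ t (b * (x - a)) ∂μ)
      ∈ rationalWithDenom (denomFactor (residueCard K) 1 1) := by
  obtain ⟨G, hG⟩ := quasiChar_mem_rationalWithDenom hϖ χ 1 hb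
  convert eval_mul_mem_rationalWithDenom (setIntegral_quasiChar_mem μ hϖ hχ)
    (C ((residueCard K : ℂ)⁻¹ ^ e) * G * X ^ e) using 2 with t
  rw [setIntegral_disc_pow μ hϖ]
  simp only [add_sub_cancel_left, map_mul, map_pow, quasiChar_uniformizer, integral_const_mul,
    eval_mul, eval_C, eval_pow, eval_X, ← hG t, eval_one]
  ring

end SelfSimilarity

section FiberZeta

variable {K : Type*} [Field K] [ValuativeRel K] {ϖ : 𝒪[K]}

lemma exists_unit_eq_of_notMem_disc [TopologicalSpace K] [IsNonarchimedeanLocalField K]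
    (hϖ : Irreducible ϖ) {x : K} (hx : x ∈ 𝒪[K]) (hxϖ : x ∉ disc 0 (ϖ : K)) :
    ∃ u : (𝒪[K])ˣ, x = ((u : 𝒪[K]) : K) := by
  have hunit : IsUnit (⟨x, hx⟩ : 𝒪[K]) := by
    refine notMem_maximalIdeal.1 fun hmem => hxϖ ?_
    obtain ⟨z, hz⟩ := Ideal.mem_span_singleton.1 (hϖ.maximalIdeal_eq ▸ hmem)
    exact ⟨z, z.2, by simpa using (congrArg Subtype.val hz).symm⟩
  obtain ⟨u, hu⟩ := hunit
  exact ⟨u, by rw [hu]⟩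

lemma pow_sub_mul_pow_eq {m : ℕ} (hm : IsUnit (m : 𝒪[K])) {I : Ideal 𝒪[K]} (hI : I ≠ ⊤) (y : K)
    {v : (𝒪[K])ˣ} (hv : v ∈ principalUnits I) :
    ∃ w ∈ principalUnits I, (y * ((v : 𝒪[K]) : K)) ^ m - y ^ m
      = m * y ^ (m - 1) * (y * ((v : 𝒪[K]) : K) - y) * ((w : 𝒪[K]) : K) := by
  obtain ⟨w, hw, hsum⟩ := exists_geomSum_eq_natCast_mul hI hm (mem_principalUnits.1 hv)
  refine ⟨w, hw, ?_⟩
  have hgeom : ((v : 𝒪[K]) : K) ^ m - 1 = ((v : 𝒪[K]) - 1 : K) * (m * ((w : 𝒪[K]) : K)) := by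
    have h := mul_geom_sum (v : 𝒪[K]) m
    rw [hsum] at h
    exact_mod_cast congrArg Subtype.val h.symm
  have hm0 : m ≠ 0 := by rintro rfl; simp at hm
  have hpow := pow_sub_one_mul hm0 y
  rw [mul_pow]
  linear_combination y ^ m * hgeom - m * (v - 1 : K) * ((w : 𝒪[K]) : K) * hpow

variable [TopologicalSpace K] [IsNonarchimedeanLocalField K]

instance henselianRing_integers : HenselianRing 𝒪[K] (maximalIdeal 𝒪[K]) := by
  let := IsTopologicalAddGroup.rightUniformSpace K
  have := isUniformAddGroup_of_addCommGroup (G := K)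
  infer_instance

variable [MeasurableSpace K] [BorelSpace K] (μ : Measure K)
  (hϖ : Irreducible ϖ) {χ : (𝒪[K])ˣ →* ℂˣ} {m : ℕ}

/-- The zeta integral of `y ^ m - c` in the variable `y`, that is the inner integral of the zeta
function of `y ^ m - f x` for `c = f x`, as a function of `t = q ^ (-s)`. -/
noncomputable def fiberZeta (χ : (𝒪[K])ˣ →* ℂˣ) (m : ℕ) (c : K) (t : PuncturedDisc) : ℂ :=
  ∫ y in (𝒪[K] : Set K), quasiChar hϖ χ t (y ^ m - c) ∂μ

lemma integrableOn_quasiChar_pow_sub [IsFiniteMeasureOnCompacts μ] (hχ : Continuous χ) {c : K}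
    (hc : c ∈ 𝒪[K]) (t : PuncturedDisc) :
    IntegrableOn (fun y => quasiChar hϖ χ t (y ^ m - c)) (𝒪[K] : Set K) μ :=
  integrableOn_quasiChar_comp hϖ t hχ measurableSet_integers isCompact_integers.measure_lt_top.ne
    (by fun_prop) fun y hy => sub_mem (pow_mem hy m) hc

variable [μ.IsAddHaarMeasure]

/-- Near a root `y` of `y ^ m = c`, the integrand is `x ↦ m y ^ (m - 1) (x - y)` up to principal
units, on which `χ` is trivial. -/
lemma fiberZeta_mem_rationalWithDenom (hχ : Continuous χ) (hm : IsUnit (m : 𝒪[K])) {c : K}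
    (hc : c ∈ 𝒪[K]) (hc0 : c ≠ 0) :
    fiberZeta μ hϖ χ m c ∈ rationalWithDenom (denomFactor (residueCard K) 1 1) := by
  have hm0 : m ≠ 0 := by rintro rfl; simp at hm
  refine setIntegral_mem_of_eventually_disc_mem μ _ hϖ isCompact_integers isOpen_integers
    (integrableOn_quasiChar_pow_sub μ hϖ hχ hc) fun y hy => ?_
  by_cases hyc : y ^ m - c = 0
  · obtain ⟨I, hI, hI', hIχ⟩ := exists_principalUnits_le_ker hχ
    have hy0 : y ≠ 0 := by
      rintro rfl
      exact hc0 (by simpa [hm0] using hyc)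
    filter_upwards [eventually_disc_pow_subset hϖ (eventually_exists_principalUnit hI hI' hy0)]
      with e he
    convert setIntegral_disc_quasiChar_mem μ hϖ hχ y
      (mul_mem (m : 𝒪[K]).2 (pow_mem hy (m - 1))) e using 2 with t
    refine setIntegral_congr_fun
      (isOpen_disc y (pow_ne_zero e (uniformizer_ne_zero hϖ))).measurableSet fun x hx => ?_
    obtain ⟨v, hv, rfl⟩ := he hx
    obtain ⟨w, hw, hvw⟩ := pow_sub_mul_pow_eq hm hI' y hv
    rw [← sub_eq_zero.1 hyc, hvw, map_mul, quasiChar_eq_one hϖ t (hIχ hw), mul_one]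
    rfl
  · exact eventually_setIntegral_disc_mem μ _ hϖ
      (eventually_quasiChar_comp_eq hϖ hχ (g := fun y => y ^ m - c) (by fun_prop) hyc)
      (quasiChar_mem_rationalWithDenom hϖ χ _ (sub_mem (pow_mem hy m) hc))

lemma fiberZeta_mul_principalUnit {I : Ideal 𝒪[K]} (hI : I ≠ ⊤) (hIχ : principalUnits I ≤ χ.ker)
    (hm : IsUnit (m : 𝒪[K])) (c : K) {v : (𝒪[K])ˣ} (hv : v ∈ principalUnits I) :
    fiberZeta μ hϖ χ m (c * ((v : 𝒪[K]) : K)) = fiberZeta μ hϖ χ m c := by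
  obtain ⟨w, -, rfl⟩ := exists_principalUnit_pow_eq hI hm hv
  ext t
  rw [fiberZeta, ← setIntegral_integers_unit_mul μ w, fiberZeta]
  congr 1 with y
  have hfactor : (((w : 𝒪[K]) : K) * y) ^ m - c * (((w ^ m : (𝒪[K])ˣ) : 𝒪[K]) : K)
      = (((w ^ m : (𝒪[K])ˣ) : 𝒪[K]) : K) * (y ^ m - c) := by
    push_cast
    ring
  rw [hfactor, map_mul, quasiChar_eq_one hϖ t (hIχ hv), one_mul]

lemma eventually_fiberZeta_comp_eq (hχ : Continuous χ) (hm : IsUnit (m : 𝒪[K])) {X : Type*}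
    [TopologicalSpace X] {g : X → K} {x : X} (hg : ContinuousAt g x) (hx : g x ≠ 0) :
    ∀ᶠ y in 𝓝 x, fiberZeta μ hϖ χ m (g y) = fiberZeta μ hϖ χ m (g x) := by
  obtain ⟨I, hI, hI', hIχ⟩ := exists_principalUnits_le_ker hχ
  filter_upwards [hg.eventually (eventually_exists_principalUnit hI hI' hx)]
  rintro y ⟨v, hv, hy⟩
  rw [hy, fiberZeta_mul_principalUnit μ hϖ hI' hIχ hm _ hv]

lemma exists_fiberZeta_uniformizer_pow_mul (hχ : Continuous χ) {I : Ideal 𝒪[K]} (hI : I ≠ ⊤)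
    (hIχ : principalUnits I ≤ χ.ker) (m : ℕ) :
    ∃ A : ℂ, ∀ c : 𝒪[K], c ∈ I → ∀ t : PuncturedDisc, fiberZeta μ hϖ χ m ((ϖ : K) ^ m * c) t
      = A + (residueCard K : ℂ)⁻¹ * (t : ℂ) ^ m * fiberZeta μ hϖ χ m c t := by
  refine ⟨∫ y in (𝒪[K] : Set K) \ disc 0 (ϖ : K), charAC ϖ χ y ^ m ∂μ, fun c hc t => ?_⟩
  have hcO : (ϖ : K) ^ m * c ∈ 𝒪[K] := (ϖ ^ m * c).2
  have hsplit := setIntegral_integers_eq_add μ hϖ 1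
    (integrableOn_quasiChar_pow_sub μ hϖ hχ (m := m) hcO t)
  simp only [pow_one] at hsplit
  rw [fiberZeta, hsplit]
  congr 1
  · refine setIntegral_congr_fun (measurableSet_integers.diff
      (isOpen_disc 0 (uniformizer_ne_zero hϖ)).measurableSet) fun y hy => ?_
    obtain ⟨u, rfl⟩ := exists_unit_eq_of_notMem_disc hϖ hy.1 hy.2
    obtain ⟨v, hv, huv⟩ := exists_eq_mul_principalUnit hI (x := (u : 𝒪[K]) ^ m - ϖ ^ m * c)
      (u := u ^ m) (by simpa using I.mul_mem_left (ϖ ^ m) hc)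
    have huvK : ((u : 𝒪[K]) : K) ^ m - (ϖ : K) ^ m * c
        = ((u : 𝒪[K]) : K) ^ m * ((v : 𝒪[K]) : K) := by
      exact_mod_cast congrArg Subtype.val huv
    rw [huvK, map_mul, quasiChar_eq_one hϖ t (hIχ hv), mul_one, map_pow, quasiChar_apply, ord_unit,
      zpow_zero, mul_one]
  · rw [fiberZeta, mul_assoc, ← integral_const_mul ((t : ℂ) ^ m)]
    congr 2 with y
    rw [mul_pow, ← mul_sub, map_mul, map_pow, quasiChar_uniformizer]

lemma exists_fiberZeta_uniformizer_pow_pow_mul (hχ : Continuous χ) {I : Ideal 𝒪[K]} (hI : I ≠ ⊤)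
    (hIχ : principalUnits I ≤ χ.ker) (m j : ℕ) :
    ∃ P : ℂ[X], ∀ c : 𝒪[K], c ∈ I → ∀ t : PuncturedDisc,
      fiberZeta μ hϖ χ m ((ϖ : K) ^ (m * j) * c) t = P.eval (t : ℂ)
        + (residueCard K : ℂ)⁻¹ ^ j * (t : ℂ) ^ (m * j) * fiberZeta μ hϖ χ m c t := by
  obtain ⟨A, hA⟩ := exists_fiberZeta_uniformizer_pow_mul μ hϖ hχ hI hIχ m
  induction j with
  | zero => exact ⟨0, fun c _ t => by simp⟩
  | succ j ih =>
    obtain ⟨P, hP⟩ := ih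
    refine ⟨C A + C (residueCard K : ℂ)⁻¹ * X ^ m * P, fun c hc t => ?_⟩
    have hstep := hA (ϖ ^ (m * j) * c) (I.mul_mem_left _ hc) t
    push_cast at hstep
    rw [hP c hc t, ← mul_assoc, ← pow_add] at hstep
    rw [mul_add_one, add_comm (m * j), hstep]
    simp only [eval_add, eval_mul, eval_C, eval_pow, eval_X]
    ring

lemma stronglyMeasurable_fiberZeta (hχ : Continuous χ) (t : PuncturedDisc) :
    StronglyMeasurable fun c => fiberZeta μ hϖ χ m c t := by
  refine StronglyMeasurable.integral_prod_right'
    (f := fun z : K × K => quasiChar hϖ χ t (z.2 ^ m - z.1)) (Measurable.stronglyMeasurable ?_)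
  exact (measurable_quasiChar hϖ t hχ).comp (by fun_prop)

lemma integrableOn_fiberZeta_comp (hχ : Continuous χ) {g : K → K} (hg : Measurable g)
    (hgO : ∀ x ∈ 𝒪[K], g x ∈ 𝒪[K]) (t : PuncturedDisc) :
    IntegrableOn (fun x => fiberZeta μ hϖ χ m (g x) t) (𝒪[K] : Set K) μ := by
  obtain ⟨B, hB⟩ := exists_norm_quasiChar_le hϖ hχ
  have hfin : μ (𝒪[K] : Set K) < ⊤ := isCompact_integers.measure_lt_top
  refine IntegrableOn.of_bound hfin ((stronglyMeasurable_fiberZeta μ hϖ hχ t).comp_measurable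
    hg).aestronglyMeasurable (B * μ.real (𝒪[K] : Set K)) ?_
  refine (ae_restrict_mem measurableSet_integers).mono fun x hx => ?_
  exact norm_setIntegral_le_of_norm_le_const hfin fun y hy =>
    hB t _ (sub_mem (pow_mem hy m) (hgO x hx))

end FiberZeta

section PlaneZeta

/-- The factor of the denominator contributed by a root of multiplicity `n`, as a polynomial in
`q ^ (-s)`; see `rootFactor`. -/
noncomputable def rootDenom (q m n : ℕ) : ℂ[X] :=
  denomFactor q (m / n.gcd m + n / n.gcd m) (n / n.gcd m * (m / n.gcd m) * n.gcd m)

/-- The denominator of the zeta function of `y ^ m - f x`, as a polynomial in `q ^ (-s)`. Here `S`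
indexes the multiple roots of `f` in the ring of integers, and `n` gives their multiplicities. -/
noncomputable def zetaDenom (q m : ℕ) {ι : Type*} (S : Finset ι) (n : ι → ℕ) : ℂ[X] :=
  denomFactor q 1 1 * ∏ i ∈ S, rootDenom q m (n i)

variable {K : Type*} [Field K] [ValuativeRel K] [TopologicalSpace K]
  [IsNonarchimedeanLocalField K] [MeasurableSpace K] [BorelSpace K]
  (μ : Measure K) [μ.IsAddHaarMeasure] {ϖ : 𝒪[K]} (hϖ : Irreducible ϖ)
  {χ : (𝒪[K])ˣ →* ℂˣ} (hχ : Continuous χ) {m : ℕ}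

include hχ

lemma integrableOn_integerSquare_quasiChar_comp {g : K × K → K} (hg : Measurable g)
    (hgO : ∀ z ∈ integerSquare K, g z ∈ 𝒪[K]) (t : PuncturedDisc) :
    IntegrableOn (fun z => quasiChar hϖ χ t (g z)) (integerSquare K) (μ.prod μ) :=
  integrableOn_quasiChar_comp hϖ t hχ (measurableSet_integers.prod measurableSet_integers)
    (isCompact_integers.prod isCompact_integers).measure_lt_top.ne hg hgO

lemma setIntegral_fiberZeta_mul_pow_mem (hm : IsUnit (m : 𝒪[K])) {I : Ideal 𝒪[K]} (hI : I ≠ ⊤)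
    (hIχ : principalUnits I ≤ χ.ker) {β : 𝒪[K]} (hβ : β ∈ I) (hβ0 : β ≠ 0) (n : ℕ) :
    (fun t => ∫ z in (𝒪[K] : Set K), fiberZeta μ hϖ χ m (β * z ^ n) t ∂μ)
      ∈ rationalWithDenom (denomFactor (residueCard K) 1 1 * rootDenom (residueCard K) m n) := by
  have hβ0' : (β : K) ≠ 0 := by simpa using hβ0
  have hgO : ∀ z ∈ 𝒪[K], (β : K) * z ^ n ∈ 𝒪[K] := fun z hz => mul_mem β.2 (pow_mem hz n)
  have hexp : n / n.gcd m * (m / n.gcd m) * n.gcd m = m * (n / n.gcd m) := by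
    rw [mul_assoc, Nat.div_mul_cancel (n.gcd_dvd_right m), mul_comm]
  have hexp' : m / n.gcd m * n = m * (n / n.gcd m) := by
    rw [Nat.div_mul_right_comm (n.gcd_dvd_right m), Nat.mul_div_assoc _ (n.gcd_dvd_left m)]
  obtain ⟨P, hP⟩ := exists_fiberZeta_uniformizer_pow_pow_mul μ hϖ hχ hI hIχ m (n / n.gcd m)
  refine setIntegral_mem_of_self_similar μ hϖ (P := P)
    (integrableOn_fiberZeta_comp μ hϖ hχ (by fun_prop) hgO)
    (fun z _ hz => eventually_fiberZeta_comp_eq μ hϖ hχ hm (g := fun z => (β : K) * z ^ n)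
      (by fun_prop) (mul_ne_zero hβ0' (pow_ne_zero n hz)))
    (fun z hz hz0 => fiberZeta_mem_rationalWithDenom μ hϖ hχ hm (hgO z hz)
      (mul_ne_zero hβ0' (pow_ne_zero n hz0))) fun z hz t => ?_
  have hstep := hP (β * ⟨z, hz⟩ ^ n) (I.mul_mem_right _ hβ) t
  rw [hexp, mul_pow, ← pow_mul, hexp', mul_left_comm]
  exact hstep

lemma setIntegral_quasiChar_sub_mul_mem {b β : K} (hb : b ∈ 𝒪[K]) (hβ : β ∈ 𝒪[K]) :
    (fun t => ∫ z in (𝒪[K] : Set K), quasiChar hϖ χ t (b - β * z) ∂μ)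
      ∈ rationalWithDenom (denomFactor (residueCard K) 1 1) := by
  by_cases hroot : ∃ r ∈ 𝒪[K], b = β * r
  · obtain ⟨r, hr, rfl⟩ := hroot
    have hdisc : disc r ((ϖ : K) ^ 0) = (𝒪[K] : Set K) := by simpa using disc_eq_integers hr 1
    convert setIntegral_disc_quasiChar_mem μ hϖ hχ r (neg_mem hβ) 0 using 6
    · exact hdisc.symm
    · ring
  · refine setIntegral_mem_of_eventually_disc_mem μ _ hϖ isCompact_integers isOpen_integers
      (fun t => integrableOn_quasiChar_comp hϖ t hχ measurableSet_integers
        isCompact_integers.measure_lt_top.ne (by fun_prop)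
        fun z hz => sub_mem hb (mul_mem hβ hz)) fun z hz => ?_
    exact eventually_setIntegral_disc_mem μ _ hϖ
      (eventually_quasiChar_comp_eq hϖ hχ (g := fun z => b - β * z) (by fun_prop)
        fun h => hroot ⟨z, hz, sub_eq_zero.1 h⟩)
      (quasiChar_mem_rationalWithDenom hϖ χ _ (sub_mem hb (mul_mem hβ hz)))

/-- Integrating over `z` first shows that a simple root contributes no new factor. -/
lemma setIntegral_fiberZeta_mul_mem {β : 𝒪[K]} (hβ0 : β ≠ 0) :
    (fun t => ∫ z in (𝒪[K] : Set K), fiberZeta μ hϖ χ m (β * z) t ∂μ)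
      ∈ rationalWithDenom (denomFactor (residueCard K) 1 1) := by
  have hint (t : PuncturedDisc) : Integrable (fun p : K × K => quasiChar hϖ χ t (p.2 ^ m - β * p.1))
      ((μ.restrict (𝒪[K] : Set K)).prod (μ.restrict (𝒪[K] : Set K))) := by
    rw [Measure.prod_restrict]
    exact integrableOn_integerSquare_quasiChar_comp μ hϖ hχ (by fun_prop)
      (fun p hp => sub_mem (pow_mem hp.2 m) (mul_mem β.2 hp.1)) t
  have hswap : (fun t => ∫ z in (𝒪[K] : Set K), fiberZeta μ hϖ χ m (β * z) t ∂μ)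
      = fun t => ∫ y in (𝒪[K] : Set K), ∫ z in (𝒪[K] : Set K),
        quasiChar hϖ χ t (y ^ m - β * z) ∂μ ∂μ :=
    funext fun t => integral_integral_swap (hint t)
  rw [hswap]
  refine setIntegral_mem_of_eventually_disc_mem μ _ hϖ isCompact_integers isOpen_integers
    (fun t => (hint t).integral_prod_right) fun y hy => ?_
  refine eventually_setIntegral_disc_mem μ _ hϖ ?_
    (setIntegral_quasiChar_sub_mul_mem μ hϖ hχ (pow_mem hy m) β.2)
  filter_upwards [disc_mem_nhds y (by simpa using hβ0 : (β : K) ≠ 0)]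
  rintro _ ⟨w, hw, rfl⟩
  ext t
  obtain ⟨r, hr⟩ : β ∣ (⟨y, hy⟩ + β * ⟨w, hw⟩) ^ m - ⟨y, hy⟩ ^ m :=
    (Dvd.intro ⟨w, hw⟩ (by ring)).trans (sub_dvd_pow_sub_pow _ _ m)
  have hrK : (y + β * w) ^ m - y ^ m = (β * r : K) := by
    simpa using congrArg Subtype.val hr
  simp only
  rw [← setIntegral_integers_add_left μ r.2]
  congr 2 with z
  congr 1
  linear_combination hrK

omit hχ in
lemma eventually_setIntegral_disc_fiberZeta_eq {I : Ideal 𝒪[K]} (hI : I ≠ ⊥) (hI' : I ≠ ⊤)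
    (hIχ : principalUnits I ≤ χ.ker) (hm : IsUnit (m : 𝒪[K])) {U : K → K} {a : K}
    (hU : ContinuousAt U a) (hUa : U a ≠ 0) {n : ℕ} (hn : n ≠ 0) :
    ∀ᶠ e in atTop, ∃ β ∈ I, β ≠ 0 ∧
      (fun t => ∫ x in disc a ((ϖ : K) ^ e), fiberZeta μ hϖ χ m (U x * (x - a) ^ n) t ∂μ)
        = (residueCard K : ℂ)⁻¹ ^ e •
          fun t => ∫ z in (𝒪[K] : Set K), fiberZeta μ hϖ χ m (β * z ^ n) t ∂μ := by
  have hsmall : Tendsto (fun e : ℕ => U a * ((ϖ : K) ^ e) ^ n) atTop (𝓝 0) := by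
    simpa [hn] using ((tendsto_uniformizer_pow hϖ).pow n).const_mul (U a)
  filter_upwards [hsmall.eventually (eventually_exists_mem_ideal hI),
    eventually_disc_pow_subset hϖ (hU.eventually (eventually_exists_principalUnit hI hI' hUa))]
    with e ⟨β, hβ, hβe⟩ hunit
  have hβ0 : β ≠ 0 := by
    rintro rfl
    exact mul_ne_zero hUa (pow_ne_zero n (pow_ne_zero e (uniformizer_ne_zero hϖ))) hβe
  refine ⟨β, hβ, hβ0, funext fun t => ?_⟩
  rw [setIntegral_disc_pow μ hϖ, Pi.smul_apply, smul_eq_mul]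
  congr 1
  refine setIntegral_congr_fun measurableSet_integers fun z hz => ?_
  obtain ⟨v, hv, hUv⟩ := hunit ⟨z, hz, rfl⟩
  simp only at hUv ⊢
  have hfactor : U a * ((v : 𝒪[K]) : K) * (a + (ϖ : K) ^ e * z - a) ^ n
      = β * z ^ n * ((v : 𝒪[K]) : K) := by
    rw [← hβe]
    ring
  rw [hUv, hfactor, fiberZeta_mul_principalUnit μ hϖ hI' hIχ hm _ hv]

variable {ι : Type*} [Fintype ι] {γ : ι → K} {n : ι → ℕ}

open Classical in
lemma setIntegral_fiberZeta_prod_mem (hm : IsUnit (m : 𝒪[K])) (hγ : Function.Injective γ)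
    {h : K → K} (hc : Continuous h) (h0 : ∀ x ∈ 𝒪[K], h x ≠ 0)
    (hO : ∀ x ∈ 𝒪[K], h x * ∏ i, (x - γ i) ^ n i ∈ 𝒪[K]) :
    (fun t => ∫ x in (𝒪[K] : Set K), fiberZeta μ hϖ χ m (h x * ∏ i, (x - γ i) ^ n i) t ∂μ)
      ∈ rationalWithDenom (zetaDenom (residueCard K) m {i | γ i ∈ 𝒪[K] ∧ 2 ≤ n i} n) := by
  have hFc : Continuous fun x => h x * ∏ i, (x - γ i) ^ n i := by fun_prop
  refine setIntegral_mem_of_eventually_disc_mem μ _ hϖ isCompact_integers isOpen_integers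
    (integrableOn_fiberZeta_comp μ hϖ hχ hFc.measurable hO) fun x hx => ?_
  by_cases hroot : ∃ i, γ i = x ∧ n i ≠ 0
  · obtain ⟨i, rfl, hni⟩ := hroot
    obtain ⟨I, hI, hI', hIχ⟩ := exists_principalUnits_le_ker hχ
    have hsplit (x : K) : h x * ∏ j, (x - γ j) ^ n j
        = (h x * ∏ j ∈ Finset.univ.erase i, (x - γ j) ^ n j) * (x - γ i) ^ n i := by
      rw [← Finset.mul_prod_erase _ _ (Finset.mem_univ i)]
      ring
    have hcofactor : h (γ i) * ∏ j ∈ Finset.univ.erase i, (γ i - γ j) ^ n j ≠ 0 :=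
      mul_ne_zero (h0 _ hx) <| Finset.prod_ne_zero_iff.2 fun j hj =>
        pow_ne_zero _ (sub_ne_zero.2 (hγ.ne (Finset.ne_of_mem_erase hj).symm))
    simp only [hsplit]
    filter_upwards [eventually_setIntegral_disc_fiberZeta_eq μ hϖ hI hI' hIχ hm
      (U := fun x => h x * ∏ j ∈ Finset.univ.erase i, (x - γ j) ^ n j) (by fun_prop) hcofactor hni]
      with e ⟨β, hβ, hβ0, he⟩
    rw [he]
    refine Submodule.smul_mem _ _ ?_
    rcases (Nat.one_le_iff_ne_zero.2 hni).eq_or_lt with hi | hi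
    · simp only [← hi, pow_one]
      exact rationalWithDenom_mono (dvd_mul_right _ _)
        (setIntegral_fiberZeta_mul_mem μ hϖ hχ hβ0)
    · refine rationalWithDenom_mono (mul_dvd_mul_left _ ?_)
        (setIntegral_fiberZeta_mul_pow_mem μ hϖ hχ hm hI' hIχ hβ hβ0 (n i))
      exact Finset.dvd_prod_of_mem (fun i => rootDenom (residueCard K) m (n i))
        (by simpa using ⟨hx, hi⟩)
  · have hne : h x * ∏ i, (x - γ i) ^ n i ≠ 0 := by
      refine mul_ne_zero (h0 x hx) (Finset.prod_ne_zero_iff.2 fun i _ => ?_)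
      rw [Ne, pow_eq_zero_iff', sub_eq_zero, eq_comm]
      exact fun hi => hroot ⟨i, hi⟩
    exact eventually_setIntegral_disc_mem μ _ hϖ
      (eventually_fiberZeta_comp_eq μ hϖ hχ hm hFc.continuousAt hne)
      (rationalWithDenom_mono (dvd_mul_right _ _)
        (fiberZeta_mem_rationalWithDenom μ hϖ hχ hm (hO x hx) hne))

end PlaneZeta

section ComplexPowers

variable {q : ℕ}

lemma exists_int_of_one_sub_cpow_eq_zero (hq : 1 < q) {a b s : ℂ} (hb : b ≠ 0)
    (h : 1 - (q : ℂ) ^ (-a - b * s) = 0) :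
    ∃ l : ℤ, s = (-a + 2 * Real.pi * Complex.I * l / Real.log q) / b := by
  have hq0 : (q : ℂ) ≠ 0 := by exact_mod_cast (zero_lt_one.trans hq).ne'
  have hlog : (Real.log q : ℂ) ≠ 0 :=
    Complex.ofReal_ne_zero.2 (Real.log_pos (by exact_mod_cast hq)).ne'
  obtain ⟨l, hl⟩ : ∃ l : ℤ, Real.log q * (-a - b * s) = l * (2 * Real.pi * Complex.I) := by
    rw [← Complex.exp_eq_one_iff, Complex.natCast_log, ← Complex.cpow_def_of_ne_zero hq0]
    exact (sub_eq_zero.1 h).symm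
  refine ⟨-l, ?_⟩
  rw [eq_div_iff hb, ← sub_eq_iff_eq_add', eq_div_iff hlog, Int.cast_neg]
  linear_combination -hl

lemma eval_denomFactor_cpow (hq : q ≠ 0) (a b : ℕ) (s : ℂ) :
    (denomFactor q a b).eval ((q : ℂ) ^ (-s)) = 1 - (q : ℂ) ^ (-(a : ℂ) - (b : ℂ) * s) := by
  have hq0 : (q : ℂ) ≠ 0 := Nat.cast_ne_zero.2 hq
  rw [eval_denomFactor, sub_eq_add_neg (-(a : ℂ)), Complex.cpow_add _ _ hq0,
    Complex.cpow_neg _ (a : ℂ), Complex.cpow_natCast, inv_pow, ← mul_neg, Complex.cpow_nat_mul]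

lemma eval_rootDenom_cpow (hq : q ≠ 0) (m n : ℕ) (s : ℂ) :
    (rootDenom q m n).eval ((q : ℂ) ^ (-s)) = rootFactor q m n s := by
  rw [rootDenom, eval_denomFactor_cpow hq, rootFactor]
  push_cast
  congr 2
  ring

lemma eval_denomFactor_ne_zero (hq : 1 < q) {a : ℕ} (ha : a ≠ 0) (b : ℕ) (t : PuncturedDisc) :
    (denomFactor q a b).eval (t : ℂ) ≠ 0 := by
  have hlt : ‖(q : ℂ)⁻¹ ^ a * (t : ℂ) ^ b‖ < 1 := by
    rw [norm_mul, norm_pow, norm_pow, norm_inv, Complex.norm_natCast]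
    exact mul_lt_one_of_nonneg_of_lt_one_left (by positivity)
      (pow_lt_one₀ (by positivity) (inv_lt_one_of_one_lt₀ (by exact_mod_cast hq)) ha)
      (pow_le_one₀ (norm_nonneg _) t.2.2.le)
  rw [eval_denomFactor, sub_ne_zero]
  intro h
  exact absurd hlt (by rw [← h, norm_one]; exact lt_irrefl 1)

variable {m : ℕ}

lemma exists_int_of_rootFactor_eq_zero (hq : 1 < q) (hm : m ≠ 0) {n : ℕ} (hn : n ≠ 0) {s : ℂ}
    (h : rootFactor q m n s = 0) :
    ∃ l : ℤ, s = (-(((n / n.gcd m : ℕ) : ℂ) + ((m / n.gcd m : ℕ) : ℂ))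
        + 2 * Real.pi * Complex.I * l / Real.log q) /
      (((n / n.gcd m : ℕ) : ℂ) * ((m / n.gcd m : ℕ) : ℂ) * ((n.gcd m : ℕ) : ℂ)) := by
  refine exists_int_of_one_sub_cpow_eq_zero hq ?_ (by rw [neg_add', ← h, rootFactor])
  have hn' : n / n.gcd m ≠ 0 := (Nat.div_gcd_pos_of_pos_left m (Nat.pos_of_ne_zero hn)).ne'
  have hm' : m / n.gcd m ≠ 0 := (Nat.div_gcd_pos_of_pos_right n (Nat.pos_of_ne_zero hm)).ne'
  exact_mod_cast mul_ne_zero (mul_ne_zero hn' hm') (Nat.gcd_ne_zero_left hn)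

section Denominator

variable {ι : Type*} (S : Finset ι) (n : ι → ℕ)

lemma eval_zetaDenom_cpow (hq : q ≠ 0) (s : ℂ) :
    (zetaDenom q m S n).eval ((q : ℂ) ^ (-s))
      = (1 - (q : ℂ) ^ (-1 - s)) * ∏ i ∈ S, rootFactor q m (n i) s := by
  simp [zetaDenom, eval_prod, eval_denomFactor_cpow hq, eval_rootDenom_cpow hq]

lemma eval_zetaDenom_ne_zero (hq : 1 < q) (hm : m ≠ 0) (t : PuncturedDisc) :
    (zetaDenom q m S n).eval (t : ℂ) ≠ 0 := by
  rw [zetaDenom, eval_mul, eval_prod]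
  refine mul_ne_zero (eval_denomFactor_ne_zero hq one_ne_zero 1 t)
    (Finset.prod_ne_zero_iff.2 fun i _ => eval_denomFactor_ne_zero hq ?_ _ t)
  exact (Nat.add_pos_left (Nat.div_gcd_pos_of_pos_right _ (Nat.pos_of_ne_zero hm)) _).ne'

variable {S n}

lemma exists_int_of_eval_zetaDenom_eq_zero (hq : 1 < q) (hm : m ≠ 0) (hn : ∀ i ∈ S, n i ≠ 0)
    {s : ℂ} (h : (zetaDenom q m S n).eval ((q : ℂ) ^ (-s)) = 0) :
    (∃ l : ℤ, s = -1 + 2 * Real.pi * Complex.I * l / Real.log q) ∨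
      ∃ i ∈ S, ∃ l : ℤ, s = (-(((n i / (n i).gcd m : ℕ) : ℂ) + ((m / (n i).gcd m : ℕ) : ℂ))
          + 2 * Real.pi * Complex.I * l / Real.log q) /
        (((n i / (n i).gcd m : ℕ) : ℂ) * ((m / (n i).gcd m : ℕ) : ℂ)
          * (((n i).gcd m : ℕ) : ℂ)) := by
  rw [eval_zetaDenom_cpow _ _ (zero_lt_one.trans hq).ne', mul_eq_zero,
    Finset.prod_eq_zero_iff] at h
  refine h.imp (fun h => ?_) fun ⟨i, hi, h⟩ =>
    ⟨i, hi, exists_int_of_rootFactor_eq_zero hq hm (hn i hi) h⟩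
  simpa using exists_int_of_one_sub_cpow_eq_zero hq one_ne_zero (a := 1) (by rwa [one_mul])

end Denominator

lemma analyticAt_eval_cpow_neg (hq : q ≠ 0) (P : ℂ[X]) (s : ℂ) :
    AnalyticAt ℂ (fun s : ℂ => P.eval ((q : ℂ) ^ (-s))) s := by
  have hcpow : Differentiable ℂ fun s : ℂ => (q : ℂ) ^ (-s) :=
    differentiable_neg.const_cpow (.inl (Nat.cast_ne_zero.2 hq))
  exact (P.differentiable.comp hcpow).analyticAt s

lemma meromorphicAt_eval_div_eval_cpow_neg (hq : q ≠ 0) (G D : ℂ[X]) (s : ℂ) :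
    MeromorphicAt (fun s : ℂ => G.eval ((q : ℂ) ^ (-s)) / D.eval ((q : ℂ) ^ (-s))) s :=
  (analyticAt_eval_cpow_neg hq G s).meromorphicAt.div
    (analyticAt_eval_cpow_neg hq D s).meromorphicAt

lemma eval_cpow_neg_eq_zero_of_meromorphicOrderAt_neg (hq : q ≠ 0) {G D : ℂ[X]} {s : ℂ}
    (h : meromorphicOrderAt
      (fun s : ℂ => G.eval ((q : ℂ) ^ (-s)) / D.eval ((q : ℂ) ^ (-s))) s < 0) :
    D.eval ((q : ℂ) ^ (-s)) = 0 := by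
  contrapose! h
  exact ((analyticAt_eval_cpow_neg hq G s).div
    (analyticAt_eval_cpow_neg hq D s) h).meromorphicOrderAt_nonneg

/-- The point `t = q ^ (-s)` of the punctured unit disc, for `Re s > 0`. -/
noncomputable def negCpow (hq : 1 < q) {s : ℂ} (hs : 0 < s.re) : PuncturedDisc where
  val := (q : ℂ) ^ (-s)
  property := by
    have hq0 : 0 < q := zero_lt_one.trans hq
    refine ⟨by simp [Complex.cpow_eq_zero_iff, hq0.ne'], ?_⟩
    rw [Complex.norm_natCast_cpow_of_pos hq0]
    exact Real.rpow_lt_one_of_one_lt_of_neg (by exact_mod_cast hq) (by simpa using hs)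

end ComplexPowers

section PlaneZetaValue

variable {K : Type*} [Field K] [ValuativeRel K] [TopologicalSpace K]
  [IsNonarchimedeanLocalField K]

lemma absVal_cpow {x : K} (hx : x ≠ 0) (s : ℂ) :
    (absVal x : ℂ) ^ s = ((residueCard K : ℂ) ^ (-s)) ^ ord x := by
  have hq : (0 : ℝ) ≤ residueCard K := Nat.cast_nonneg _
  rw [absVal, if_neg hx, ← Real.rpow_intCast, ← Complex.cpow_mul_ofReal_nonneg hq,
    ← Complex.cpow_mul_int]
  push_cast
  congr 1
  ring

variable {ϖ : 𝒪[K]} (hϖ : Irreducible ϖ)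

lemma zetaIntegrand_eq_quasiChar (χ : (𝒪[K])ˣ →* ℂˣ) (g : K × K → K) {s : ℂ} (hs : 0 < s.re) :
    zetaIntegrand ϖ χ g s
      = fun z => quasiChar hϖ χ (negCpow (one_lt_residueCard K) hs) (g z) := by
  ext z
  rw [zetaIntegrand, quasiChar_apply]
  rcases eq_or_ne (g z) 0 with hz | hz
  · rw [hz, charAC_zero ϖ hϖ, zero_mul, zero_mul]
  · rw [absVal_cpow hz, negCpow]

variable [MeasurableSpace K] [BorelSpace K] (μ : Measure K) [μ.IsAddHaarMeasure]
  {χ : (𝒪[K])ˣ →* ℂˣ} (hχ : Continuous χ)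

include hϖ hχ

lemma integrableOn_zetaIntegrand {g : K × K → K} (hg : Measurable g)
    (hgO : ∀ z ∈ integerSquare K, g z ∈ 𝒪[K]) {s : ℂ} (hs : 0 < s.re) :
    IntegrableOn (zetaIntegrand ϖ χ g s) (integerSquare K) (μ.prod μ) := by
  rw [zetaIntegrand_eq_quasiChar hϖ χ g hs]
  exact integrableOn_integerSquare_quasiChar_comp μ hϖ hχ hg hgO _

lemma igusaZeta_pow_sub_eq_setIntegral_fiberZeta {F : K → K} (hF : Measurable F)
    (hFO : ∀ x ∈ 𝒪[K], F x ∈ 𝒪[K]) (m : ℕ) {s : ℂ} (hs : 0 < s.re) :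
    igusaZeta μ ϖ χ (fun z => z.2 ^ m - F z.1) s
      = ∫ x in (𝒪[K] : Set K),
          fiberZeta μ hϖ χ m (F x) (negCpow (one_lt_residueCard K) hs) ∂μ := by
  rw [igusaZeta, zetaIntegrand_eq_quasiChar hϖ χ _ hs]
  exact setIntegral_prod _ <| integrableOn_integerSquare_quasiChar_comp μ hϖ hχ (by fun_prop)
    (fun z hz => sub_mem (pow_mem hz.2 m) (hFO z.1 hz.1)) _

end PlaneZetaValue

section IntegralPolynomials

variable {K : Type*} [Field K] [ValuativeRel K]

lemma aeval_mem_integers (f : (𝒪[K])[X]) {x : K} (hx : x ∈ 𝒪[K]) : aeval x f ∈ 𝒪[K] := by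
  have hval : aeval x f = ((f.eval ⟨x, hx⟩ : 𝒪[K]) : K) :=
    aeval_algebraMap_apply_eq_algebraMap_eval (A := K) (⟨x, hx⟩ : 𝒪[K]) f
  exact hval ▸ (f.eval _).2

end IntegralPolynomials

end LocalZeta


open Classical LocalZeta in
theorem theorem1p2_general
    {K : Type*} [Field K] [ValuativeRel K] [TopologicalSpace K] [IsNonarchimedeanLocalField K]
    [MeasurableSpace K] [BorelSpace K] (μ : Measure K) [μ.IsAddHaarMeasure]
    (ϖ : 𝒪[K]) (hϖ : Irreducible ϖ) (χ : (𝒪[K])ˣ →* ℂˣ) (hχ : Continuous χ)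
    (m : ℕ) (hm : IsUnit (m : 𝒪[K])) (f : (𝒪[K])[X]) {ι : Type*} [Fintype ι]
    (h : K[X]) (h0 : ∀ x ∈ 𝒪[K], h.eval x ≠ 0)
    (γ : ι → K) (hγ : Function.Injective γ) (n : ι → ℕ)
    (hf : f.map (algebraMap 𝒪[K] K) = h * ∏ i, (X - C (γ i)) ^ n i) :
    let q : ℕ := residueCard K
    let g : K × K → K := fun z => z.2 ^ m - aeval z.1 f
    let T : Finset ι := Finset.univ.filter fun i => γ i ∈ 𝒪[K]
    ∃ G : ℂ[X],
      let R : ℂ → ℂ := fun s => G.eval ((q : ℂ) ^ (-s)) /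
        ((1 - (q : ℂ) ^ (-1 - s)) * ∏ i ∈ T with 2 ≤ n i, rootFactor q m (n i) s)
      (∀ s : ℂ, 0 < s.re →
        IntegrableOn (zetaIntegrand ϖ χ g s) (integerSquare K) (μ.prod μ) ∧
        igusaZeta μ ϖ χ g s = R s) ∧
      (∀ s : ℂ, MeromorphicAt R s) ∧
      ∀ s : ℂ, meromorphicOrderAt R s < 0 →
        (∃ l : ℤ, s = -1 + 2 * Real.pi * Complex.I * l / Real.log q) ∨
        ∃ i ∈ T, 2 ≤ n i ∧ ∃ l : ℤ,
          s = (-(((n i / (n i).gcd m : ℕ) : ℂ) + ((m / (n i).gcd m : ℕ) : ℂ))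
              + 2 * Real.pi * Complex.I * l / Real.log q) /
            (((n i / (n i).gcd m : ℕ) : ℂ) * ((m / (n i).gcd m : ℕ) : ℂ)
              * (((n i).gcd m : ℕ) : ℂ)) := by
  intro q g T
  have hq : 1 < q := one_lt_residueCard K
  have hq0 : q ≠ 0 := (zero_lt_one.trans hq).ne'
  have hm0 : m ≠ 0 := by rintro rfl; simp at hm
  have hfO (x : K) (hx : x ∈ 𝒪[K]) : aeval x f ∈ 𝒪[K] := aeval_mem_integers f hx
  have hfx (x : K) : aeval x f = h.eval x * ∏ i, (x - γ i) ^ n i := by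
    rw [← eval_map_algebraMap, hf]
    simp [eval_prod]
  obtain ⟨G, hG⟩ := setIntegral_fiberZeta_prod_mem μ hϖ hχ hm hγ h.continuous h0
    fun x hx => hfx x ▸ hfO x hx
  simp only [← Finset.filter_filter, ← hfx] at hG
  refine ⟨G, ?_⟩
  simp only [← eval_zetaDenom_cpow _ n hq0]
  refine ⟨fun s hs => ⟨?_, ?_⟩, meromorphicAt_eval_div_eval_cpow_neg hq0 G _, fun s hs => ?_⟩
  · exact integrableOn_zetaIntegrand hϖ μ hχ (by fun_prop)
      (fun z hz => sub_mem (pow_mem hz.2 m) (hfO z.1 hz.1)) hs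
  · rw [igusaZeta_pow_sub_eq_setIntegral_fiberZeta hϖ μ hχ (by fun_prop) hfO m hs]
    exact eq_div_of_mul_eq (eval_zetaDenom_ne_zero _ n hq hm0 (negCpow hq hs))
      ((mul_comm _ _).trans (hG (negCpow hq hs)))
  · have hzero := eval_cpow_neg_eq_zero_of_meromorphicOrderAt_neg hq0 hs
    simpa only [Finset.mem_filter, and_assoc] using exists_int_of_eval_zetaDenom_eq_zero hq hm0
      (fun i hi => (zero_lt_two.trans_le (Finset.mem_filter.1 hi).2).ne') hzero

open Classical in
theorem theorem1p2
    {K : Type*} [Field K] [ValuativeRel K] [TopologicalSpace K] [IsNonarchimedeanLocalField K]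
    [MeasurableSpace K] [BorelSpace K]
    (p : ℕ) (hp : p.Prime) [CharP K p]
    -- the Haar measure on `K` for which the ring of integers has measure one
    (μ : Measure K) [μ.IsAddHaarMeasure] (hμ : μ (𝒪[K] : Set K) = 1)
    -- a uniformizer and a (continuous) multiplicative character of the unit group
    (ϖ : 𝒪[K]) (hϖ : Irreducible ϖ)
    (χ : (𝒪[K])ˣ →* ℂˣ) (hχ : Continuous χ)
    (m : ℕ) (hm : 2 ≤ m) (hpm : ¬ p ∣ m)
    -- `f` has integral coefficients and factors as `γ₀ ∏ (X - γ i) ^ n i` over `K`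
    (f : (𝒪[K])[X]) (k : ℕ) (γ₀ : K) (hγ₀ : γ₀ ≠ 0)
    (γ : Fin k → K) (hγ : Function.Injective γ) (n : Fin k → ℕ) (hn : ∀ i, 1 ≤ n i)
    (hf : f.map (algebraMap 𝒪[K] K) = C γ₀ * ∏ i, (X - C (γ i)) ^ n i) :
    let q : ℕ := LocalZeta.residueCard K
    let g : K × K → K := fun z => z.2 ^ m - aeval z.1 f
    let T : Finset (Fin k) := Finset.univ.filter fun i => γ i ∈ 𝒪[K]
    ∃ G : ℂ[X],
      let R : ℂ → ℂ := fun s => G.eval ((q : ℂ) ^ (-s)) /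
        ((1 - (q : ℂ) ^ (-1 - s)) * ∏ i ∈ T with 2 ≤ n i, LocalZeta.rootFactor q m (n i) s)
      -- the defining integral converges for `Re s > 0` and has the stated rational value
      (∀ s : ℂ, 0 < s.re →
        IntegrableOn (LocalZeta.zetaIntegrand ϖ χ g s) (LocalZeta.integerSquare K) (μ.prod μ) ∧
        LocalZeta.igusaZeta μ ϖ χ g s = R s) ∧
      -- so it continues meromorphically to `ℂ`, with poles only in the following list
      (∀ s : ℂ, MeromorphicAt R s) ∧
      ∀ s : ℂ, meromorphicOrderAt R s < 0 →
        (∃ l : ℤ, s = -1 + 2 * Real.pi * Complex.I * l / Real.log q) ∨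
        ∃ i ∈ T, 2 ≤ n i ∧ ∃ l : ℤ,
          s = (-(((n i / (n i).gcd m : ℕ) : ℂ) + ((m / (n i).gcd m : ℕ) : ℂ))
              + 2 * Real.pi * Complex.I * l / Real.log q) /
            (((n i / (n i).gcd m : ℕ) : ℂ) * ((m / (n i).gcd m : ℕ) : ℂ)
              * (((n i).gcd m : ℕ) : ℂ)) := by
  exact theorem1p2_general μ ϖ hϖ χ hχ m ((CharP.isUnit_natCast_iff hp).2 hpm) f (C γ₀)
    (fun _ _ => by simpa using hγ₀) γ hγ n hf
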